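/- Let $\mathbf{k}$ be a field. For $m,n\ge 0$ let ${}_mB^-_n$ be the set of isotopy classes of planar diagrams in the strip $0\le x\le 1$ with $m$ marked points on the line $x=0$ and $n$ marked points on the line $x=1$, in which some $k\le\min(m,n)$ of the left points are joined to $k$ of the right points by disjoint arcs (larcs), each remaining marked point is the end of a short arc (sarc) whose other end lies in the interior of the strip, and the projection to the $x$-axis has no critical points. (Such a class is the same as an order-preserving bijection between a subset of the $m$ left points and a subset of the $n$ right points.) Let $A^-$ be the $\mathbf{k}$-algebra with basis $B^-=\bigsqcup_{m,n\ge0}{}_mB^-_n$, the product of $y\in{}_mB^-_n$ and $z\in{}_{n'}B^-_{l}$ being their concatenation if $n=n'$ and the concatenation has no arc disjoint from both boundary lines, and $0$ otherwise. Let $1_n\in{}_nB^-_n$ be the diagram without sarcs, and let $A^-_d$ be the span of the diagrams with exactly $d$ sarcs in total. Modules are left $A^-$-modules $M$ with $M=\bigoplus_{n\ge0}1_nM$. Let $L_n=\mathbf{k}1_n$ be the one-dimensional module on which $1_n$ acts as the identity and every other diagram acts by zero. A linear graded projective resolution of a module $S$, placed in degree $0$, is an exact sequence $\cdots\to P^2\to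 P^1\to P^0\to S\to0$ of graded modules and degree-preserving homomorphisms in which every $P^i$ is projective and generated by its component of degree $i$. Then $A^-$ with the grading by the total number of sarcs is a Koszul algebra. That is: the $1_n$ are non-zero orthogonal idempotents and $A^-=\bigoplus_{m,n}1_mA^-1_n$; $A^-=\bigoplus_{d\ge0}A^-_d$ with $A^-_iA^-_j\subseteq A^-_{i+j}$; $A^-_0=\bigoplus_n\mathbf{k}1_n$; and every simple module annihilated by $\bigoplus_{d>0}A^-_d$ has a linear graded projective resolution. Moreover, every module $L_n$, $n\ge0$, and indeed every simple $A^-$-module, has a linear graded projective resolution. -/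

import Mathlib

universe u v w

/-! ### Planar diagrams of long and short arcs -/

/-- An isotopy class of slarc diagrams with `left` points on the line `x = 0` and `right` points on
the line `x = 1`, both numbered from bottom to top starting with `0`. The pair `(i, j)` belongs to
`larcs` when a long arc joins the left point `i` to the right point `j`. Long arcs are disjoint and
have no critical points, so their endpoints come in the same order on both lines (and no two of
them share an endpoint); the remaining points carry short arcs, and the isotopy class is determined
by these data. -/
@[ext]
structure SlarcDiagram where
  left : ℕ
  right : ℕ
  larcs : Finset (ℕ × ℕ)
  left_lt : ∀ p ∈ larcs, p.1 < left
  right_lt : ∀ p ∈ larcs, p.2 < right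
  planar : ∀ p ∈ larcs, ∀ q ∈ larcs, p.1 < q.1 ↔ p.2 < q.2

namespace SlarcDiagram

/-- The left points that are ends of short arcs. -/
def leftSarcs (x : SlarcDiagram) : Finset ℕ :=
  (Finset.range x.left).filter fun i => ∀ p ∈ x.larcs, p.1 ≠ i

/-- The right points that are ends of short arcs. -/
def rightSarcs (x : SlarcDiagram) : Finset ℕ :=
  (Finset.range x.right).filter fun j => ∀ p ∈ x.larcs, p.2 ≠ j

/-- The total number of short arcs of a diagram. -/
def numSarcs (x : SlarcDiagram) : ℕ := x.leftSarcs.card + x.rightSarcs.card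

/-- The diagram `1_n`: `n` parallel long arcs, no short arcs. -/
def one (n : ℕ) : SlarcDiagram where
  left := n
  right := n
  larcs := (Finset.range n).image fun i => (i, i)
  left_lt := by simp
  right_lt := by simp
  planar := by simp

/-- The concatenation of `x` (on the left) with `y` (on the right), with any floating arcs removed;
only used for diagrams with `x.right = y.left`. -/
def concat (x y : SlarcDiagram) : SlarcDiagram where
  left := x.left
  right := y.right
  larcs := (Finset.range x.left ×ˢ Finset.range y.right).filter fun p =>
    ∃ q ∈ x.larcs, ∃ r ∈ y.larcs, q.1 = p.1 ∧ q.2 = r.1 ∧ r.2 = p.2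
  left_lt := by
    intro p hp
    simp only [Finset.mem_filter, Finset.mem_product, Finset.mem_range] at hp
    exact hp.1.1
  right_lt := by
    intro p hp
    simp only [Finset.mem_filter, Finset.mem_product, Finset.mem_range] at hp
    exact hp.1.2
  planar := by
    intro p hp p' hp'
    simp only [Finset.mem_filter] at hp hp'
    obtain ⟨-, q, hq, r, hr, h1, h2, h3⟩ := hp
    obtain ⟨-, q', hq', r', hr', h1', h2', h3'⟩ := hp'
    have hx := x.planar q hq q' hq'
    have hy := y.planar r hr r' hr'
    rw [← h1, ← h1', ← h3, ← h3', hx, ← hy, h2, h2']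

/-- The concatenation of `x` and `y` is defined (the numbers of points on the common line agree)
and has no floating arc: no point of the common line ends a short arc on both sides. -/
def Composable (x y : SlarcDiagram) : Prop :=
  x.right = y.left ∧ Disjoint x.rightSarcs y.leftSarcs

lemma mem_concat {x y : SlarcDiagram} {i j : ℕ} :
    (i, j) ∈ (concat x y).larcs ↔ ∃ l, (i, l) ∈ x.larcs ∧ (l, j) ∈ y.larcs := by
  simp only [concat, Finset.mem_filter, Finset.mem_product, Finset.mem_range]
  constructor
  · rintro ⟨-, ⟨a, b⟩, hq, ⟨c, d⟩, hr, h1, h2, h3⟩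
    simp only at h1 h2 h3
    subst h1 h2 h3
    exact ⟨b, hq, hr⟩
  · rintro ⟨l, h1, h2⟩
    exact ⟨⟨x.left_lt _ h1, y.right_lt _ h2⟩, _, h1, _, h2, rfl, rfl, rfl⟩

lemma larc_eq_left (x : SlarcDiagram) {i j j' : ℕ} (h : (i, j) ∈ x.larcs)
    (h' : (i, j') ∈ x.larcs) : j = j' := by
  have h1 := x.planar _ h _ h'
  have h2 := x.planar _ h' _ h
  simp only [lt_self_iff_false, false_iff] at h1 h2
  omega

lemma larc_eq_right (x : SlarcDiagram) {i i' j : ℕ} (h : (i, j) ∈ x.larcs)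
    (h' : (i', j) ∈ x.larcs) : i = i' := by
  have h1 := x.planar _ h _ h'
  have h2 := x.planar _ h' _ h
  simp only [lt_self_iff_false, iff_false] at h1 h2
  omega

lemma composable_iff {x y : SlarcDiagram} : Composable x y ↔ x.right = y.left ∧
    ∀ l < y.left, (∃ i, (i, l) ∈ x.larcs) ∨ ∃ j, (l, j) ∈ y.larcs := by
  unfold Composable
  refine and_congr_right fun h => ?_
  rw [Finset.disjoint_left]
  simp only [rightSarcs, leftSarcs, Finset.mem_filter, Finset.mem_range, Prod.forall, h]
  constructor
  · intro H l hl
    by_contra hc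
    push Not at hc
    exact H ⟨hl, fun a b hab e => hc.1 a (e ▸ hab)⟩ ⟨hl, fun a b hab e => hc.2 b (e ▸ hab)⟩
  · rintro H l ⟨hl, h1⟩ ⟨-, h2⟩
    rcases H l hl with ⟨i, hi⟩ | ⟨j, hj⟩
    · exact h1 _ _ hi rfl
    · exact h2 _ _ hj rfl

lemma concat_assoc (x y z : SlarcDiagram) :
    concat (concat x y) z = concat x (concat y z) := by
  ext1
  · rfl
  · rfl
  · ext ⟨i, j⟩
    simp only [mem_concat]
    grind

lemma composable_assoc (x y z : SlarcDiagram) :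
    (Composable x y ∧ Composable (concat x y) z) ↔
      (Composable y z ∧ Composable x (concat y z)) := by
  have e1 : (concat x y).right = y.right := rfl
  have e2 : (concat y z).left = y.left := rfl
  simp only [composable_iff, mem_concat, e1, e2]
  constructor
  · rintro ⟨⟨h1, h2⟩, h3, h4⟩
    refine ⟨⟨h3, fun l hl => ?_⟩, h1, fun l hl => ?_⟩
    · rcases h4 l hl with ⟨i, m, -, hm⟩ | h
      · exact Or.inl ⟨m, hm⟩
      · exact Or.inr h
    · rcases h2 l hl with h | ⟨j, hj⟩
      · exact Or.inl h
      · rcases h4 j (h3 ▸ y.right_lt _ hj) with ⟨i, m, hi, hm⟩ | ⟨p, hp⟩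
        · rw [y.larc_eq_right hm hj] at hi
          exact Or.inl ⟨i, hi⟩
        · exact Or.inr ⟨p, j, hj, hp⟩
  · rintro ⟨⟨h3, h4⟩, h1, h2⟩
    refine ⟨⟨h1, fun l hl => ?_⟩, h3, fun l hl => ?_⟩
    · rcases h2 l hl with h | ⟨j, m, hm, -⟩
      · exact Or.inl h
      · exact Or.inr ⟨m, hm⟩
    · rcases h4 l hl with ⟨j, hj⟩ | h
      · rcases h2 j (y.left_lt _ hj) with ⟨i, hi⟩ | ⟨p, m, hm, hp⟩
        · exact Or.inl ⟨i, j, hi, hj⟩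
        · rw [y.larc_eq_left hm hj] at hp
          exact Or.inr ⟨p, hp⟩
      · exact Or.inr h

lemma mem_one {n i j : ℕ} : (i, j) ∈ (one n).larcs ↔ i = j ∧ i < n := by
  simp only [one, Finset.mem_image, Finset.mem_range, Prod.mk.injEq]
  constructor
  · rintro ⟨a, h, rfl, rfl⟩
    exact ⟨rfl, h⟩
  · rintro ⟨rfl, h⟩
    exact ⟨i, h, rfl, rfl⟩

/-- The identity diagram is only the product of two identity diagrams. -/
lemma eq_one_iff (n : ℕ) (x y : SlarcDiagram) :
    (Composable x y ∧ concat x y = one n) ↔ (x = one n ∧ y = one n) := by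
  constructor
  · rintro ⟨hc, h⟩
    rw [composable_iff] at hc
    obtain ⟨hm, hc⟩ := hc
    have hl : x.left = n := congrArg left h
    have hr : y.right = n := congrArg right h
    have key : ∀ i < n, ∃ l, (i, l) ∈ x.larcs ∧ (l, i) ∈ y.larcs := fun i hi =>
      mem_concat.1 (h ▸ mem_one.2 ⟨rfl, hi⟩)
    choose! f hf1 hf2 using key
    have fsurj : ∀ l < y.left, ∃ i < n, f i = l := by
      intro l hl'
      rcases hc l hl' with ⟨i, hi⟩ | ⟨j, hj⟩
      · have hin : i < n := hl ▸ x.left_lt _ hi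
        exact ⟨i, hin, x.larc_eq_left (hf1 i hin) hi⟩
      · have hjn : j < n := hr ▸ y.right_lt _ hj
        exact ⟨j, hjn, y.larc_eq_right (hf2 j hjn) hj⟩
    have fmono : ∀ i < n, ∀ j < n, i < j → f i < f j := fun i hi j hj hij =>
      (x.planar _ (hf1 i hi) _ (hf1 j hj)).1 hij
    have flt : ∀ i < n, f i < y.left := fun i hi => y.left_lt _ (hf2 i hi)
    have fid : ∀ i < n, f i = i := by
      intro i
      induction i using Nat.strong_induction_on with
      | _ i ih =>
        intro hi
        have hge : i ≤ f i := by
          by_contra hlt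
          push Not at hlt
          have h1 := ih (f i) hlt (hlt.trans hi)
          have h2 := fmono _ (hlt.trans hi) _ hi hlt
          omega
        by_contra hne
        obtain ⟨j, hj, hji⟩ := fsurj i (lt_of_le_of_lt hge (flt i hi))
        rcases lt_trichotomy i j with h1 | h1 | h1
        · have := fmono _ hi _ hj h1
          omega
        · subst h1; exact hne hji
        · have := ih j h1 hj
          omega
    have hmid : y.left = n := by
      apply le_antisymm
      · by_contra hlt
        push Not at hlt
        obtain ⟨i, hi, hin⟩ := fsurj n hlt
        rw [fid i hi] at hin
        omega
      · by_contra hlt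
        push Not at hlt
        have := flt _ hlt
        rw [fid _ hlt] at this
        omega
    constructor
    · ext1
      · exact hl
      · exact hm.trans hmid
      · ext ⟨i, j⟩
        rw [mem_one]
        constructor
        · intro hij
          have hi : i < n := hl ▸ x.left_lt _ hij
          exact ⟨by rw [← fid i hi]; exact x.larc_eq_left (hf1 i hi) hij, hi⟩
        · rintro ⟨rfl, hi⟩
          have := hf1 i hi
          rwa [fid i hi] at this
    · ext1
      · exact hmid
      · exact hr
      · ext ⟨i, j⟩
        rw [mem_one]
        constructor
        · intro hij
          have hj : j < n := hr ▸ y.right_lt _ hij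
          have e : i = j := by
            rw [← fid j hj]; exact y.larc_eq_right hij (hf2 j hj)
          exact ⟨e, e ▸ hj⟩
        · rintro ⟨rfl, hi⟩
          have := hf2 i hi
          rwa [fid i hi] at this
  · rintro ⟨rfl, rfl⟩
    constructor
    · rw [composable_iff]
      exact ⟨rfl, fun l hl => Or.inl ⟨l, mem_one.2 ⟨rfl, hl⟩⟩⟩
    · ext1
      · rfl
      · rfl
      · ext ⟨i, j⟩
        simp only [mem_concat, mem_one]
        grind

end SlarcDiagram

/-! ### The algebra of slarcs -/

/-- The vector space over `k` with basis the set of all slarc diagrams. -/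
def SlarcAlgebra (k : Type u) [Field k] : Type u := SlarcDiagram →₀ k

namespace SlarcAlgebra

noncomputable section

variable (k : Type u) [Field k]

instance : AddCommGroup (SlarcAlgebra k) := inferInstanceAs (AddCommGroup (SlarcDiagram →₀ k))

instance : Module k (SlarcAlgebra k) := inferInstanceAs (Module k (SlarcDiagram →₀ k))

/-- The basis of the algebra formed by the diagrams. -/
def basis : Module.Basis SlarcDiagram k (SlarcAlgebra k) :=
  Module.Basis.ofRepr (LinearEquiv.refl k (SlarcDiagram →₀ k))

/-- The basis vector of the algebra given by a diagram. -/
def diag (x : SlarcDiagram) : SlarcAlgebra k := basis k x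

open Classical in
/-- The product of two diagrams: their concatenation, or zero if the concatenation is not defined
or contains a floating arc. -/
def diagMul (x y : SlarcDiagram) : SlarcAlgebra k :=
  if x.Composable y then diag k (x.concat y) else 0

/-- The bilinear extension of the product of diagrams. -/
def mulBilin : SlarcAlgebra k →ₗ[k] SlarcAlgebra k →ₗ[k] SlarcAlgebra k :=
  (basis k).constr k fun x => (basis k).constr k fun y => diagMul k x y

instance : Mul (SlarcAlgebra k) := ⟨fun a b => mulBilin k a b⟩

lemma mul_def (a b : SlarcAlgebra k) : a * b = mulBilin k a b := rfl

lemma diag_mul_diag (x y : SlarcDiagram) : diag k x * diag k y = diagMul k x y := by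
  rw [mul_def, mulBilin, diag, diag, Module.Basis.constr_basis, Module.Basis.constr_basis]

lemma span_diag : Submodule.span k (Set.range (diag k)) = ⊤ := (basis k).span_eq

lemma diag_assoc (x y z : SlarcDiagram) :
    diag k x * diag k y * diag k z = diag k x * (diag k y * diag k z) := by
  classical
  have h := SlarcDiagram.composable_assoc x y z
  have z1 : ∀ a : SlarcAlgebra k, (0 : SlarcAlgebra k) * a = 0 := fun a => by
    rw [mul_def, map_zero, LinearMap.zero_apply]
  have z2 : ∀ a : SlarcAlgebra k, a * (0 : SlarcAlgebra k) = 0 := fun a => by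
    rw [mul_def, map_zero]
  rw [diag_mul_diag, diag_mul_diag]
  by_cases h1 : x.Composable y <;> by_cases h2 : y.Composable z <;>
    simp only [diagMul, h1, h2, if_true, if_false, z1, z2, diag_mul_diag] at h ⊢
  · simp only [true_and] at h
    simp only [h, SlarcDiagram.concat_assoc]
  · simp only [true_and, false_and, iff_false] at h
    simp only [h, if_false]
  · simp only [true_and, false_and, false_iff] at h
    simp only [h, if_false]

lemma diag_induction {p : SlarcAlgebra k → Prop} (hd : ∀ x, p (diag k x)) (h0 : p 0)
    (ha : ∀ a b, p a → p b → p (a + b)) (hs : ∀ (c : k) a, p a → p (c • a))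
    (a : SlarcAlgebra k) : p a := by
  have h : a ∈ Submodule.span k (Set.range (diag k)) := by rw [span_diag]; trivial
  induction h using Submodule.span_induction with
  | mem x hx => obtain ⟨y, rfl⟩ := hx; exact hd y
  | zero => exact h0
  | add x y _ _ hx hy => exact ha x y hx hy
  | smul c x _ hx => exact hs c x hx

instance : NonUnitalNonAssocRing (SlarcAlgebra k) where
  left_distrib a b c := map_add (mulBilin k a) b c
  right_distrib a b c := by simp only [mul_def, map_add, LinearMap.add_apply]
  zero_mul a := by rw [mul_def, map_zero, LinearMap.zero_apply]
  mul_zero a := by rw [mul_def, map_zero]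

instance : IsScalarTower k (SlarcAlgebra k) (SlarcAlgebra k) where
  smul_assoc c a b := by
    simp only [smul_eq_mul, mul_def, map_smul, LinearMap.smul_apply]

instance : SMulCommClass k (SlarcAlgebra k) (SlarcAlgebra k) where
  smul_comm c a b := by
    simp only [smul_eq_mul, mul_def, map_smul]

instance : NonUnitalRing (SlarcAlgebra k) where
  mul_assoc a b c := by
    induction a using diag_induction with
    | hd x =>
      induction b using diag_induction with
      | hd y =>
        induction c using diag_induction with
        | hd z => exact diag_assoc k x y z
        | h0 => simp only [mul_zero]
        | ha a b h1 h2 => simp only [mul_add, h1, h2]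
        | hs c a h => simp only [mul_smul_comm, h]
      | h0 => simp only [mul_zero, zero_mul]
      | ha a b h1 h2 => simp only [mul_add, add_mul, h1, h2]
      | hs c a h => simp only [mul_smul_comm, smul_mul_assoc, h]
    | h0 => simp only [zero_mul]
    | ha a b h1 h2 => simp only [add_mul, h1, h2]
    | hs c a h => simp only [smul_mul_assoc, h]

/-- The idempotents `1_n`. -/
def idem (n : ℕ) : SlarcAlgebra k := diag k (SlarcDiagram.one n)

/-- The homogeneous component of degree `d`: the span of the diagrams with `d` short arcs. -/
def sarcGrading (d : ℕ) : Submodule k (SlarcAlgebra k) :=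
  Submodule.span k (diag k '' {x | x.numSarcs = d})

/-- The coefficient of the diagram `1_n`, a multiplicative functional. -/
def coeffOne (n : ℕ) : SlarcAlgebra k →ₙₐ[k] k :=
  let φ : SlarcAlgebra k →ₗ[k] k := (basis k).coord (SlarcDiagram.one n)
  { φ with
    map_zero' := map_zero φ
    map_mul' := by
      classical
      have hφ : ∀ x, φ (diag k x) = if x = SlarcDiagram.one n then 1 else 0 := fun x => by
        rw [diag, Module.Basis.coord_apply, Module.Basis.repr_self, Finsupp.single_apply]
      intro a b
      change φ (a * b) = φ a * φ b
      induction a using diag_induction with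
      | hd x =>
        induction b using diag_induction with
        | hd y =>
          have h := SlarcDiagram.eq_one_iff n x y
          rw [diag_mul_diag, diagMul, hφ, hφ]
          by_cases hc : x.Composable y
          · rw [if_pos hc, hφ]
            simp only [hc, true_and] at h
            simp only [h, ite_and, mul_ite, mul_one, mul_zero]
            split_ifs <;> rfl
          · rw [if_neg hc, map_zero]
            simp only [hc, false_and, false_iff, not_and] at h
            split_ifs with h1 h2
            · exact absurd h2 (h h1)
            all_goals simp
        | h0 => simp only [mul_zero, map_zero]
        | ha a b h1 h2 => simp only [mul_add, map_add, h1, h2]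
        | hs c a h => rw [mul_smul_comm, map_smul, map_smul, h, mul_smul_comm]
      | h0 => simp only [zero_mul, map_zero]
      | ha a b h1 h2 => simp only [add_mul, map_add, h1, h2]
      | hs c a h => rw [smul_mul_assoc, map_smul, map_smul, h, smul_mul_assoc] }

end

end SlarcAlgebra

/-! ### Modules over locally unital graded algebras

A left module over an algebra `A` without unit is the same as a unital left module over the algebra
`Unitization k A = k ⊕ A`; the element `a` of `A` acts as `(a : Unitization k A)`. -/

/-- The module is the direct sum of its subspaces `e i • M`. -/
def IsLocallyUnital {k A : Type u} [Field k] [NonUnitalRing A] [Module k A] [IsScalarTower k A A]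
    [SMulCommClass k A A] {ι : Type v} [DecidableEq ι] (e : ι → A) (M : Type w)
    [AddCommGroup M] [Module k M] [Module (Unitization k A) M] [IsScalarTower k (Unitization k A) M] : Prop :=
  DirectSum.IsInternal fun i => LinearMap.range (Algebra.lsmul k k M (e i : Unitization k A))

/-- A linear graded projective resolution
`⋯ → P 2 → P 1 → P 0 → S → 0` of a module `S` placed in degree `0`: every `P i` is a graded
(locally unital) projective module generated by its component of degree `i`, and all maps preserve
degrees. Since `A` is graded by the natural numbers, such a `P i` has no components of negative
degree. For a locally unital module, projectivity over `Unitization k A` is the same as projectivity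
in the category of locally unital modules, because `A e_i = (Unitization k A) e_i`. -/
structure LinearResolution {k A : Type u} [Field k] [NonUnitalRing A] [Module k A]
    [IsScalarTower k A A] [SMulCommClass k A A] {ι : Type v} [DecidableEq ι] (e : ι → A)
    (𝒜 : ℕ → Submodule k A) (S : Type w) [AddCommGroup S] [Module (Unitization k A) S] where
  P : ℕ → Type u
  [addCommGroup : ∀ i, AddCommGroup (P i)]
  [moduleBase : ∀ i, Module k (P i)]
  [module : ∀ i, Module (Unitization k A) (P i)]
  [isScalarTower : ∀ i, IsScalarTower k (Unitization k A) (P i)]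
  locallyUnital : ∀ i, IsLocallyUnital (k := k) e (P i)
  projective : ∀ i, Module.Projective (Unitization k A) (P i)
  /-- `grading i j` is the component of degree `j` of `P i`. -/
  grading : ∀ i, ℕ → Submodule k (P i)
  isInternal : ∀ i, DirectSum.IsInternal (grading i)
  smul_mem : ∀ i j l, ∀ a ∈ 𝒜 j, ∀ x ∈ grading i l, (a : Unitization k A) • x ∈ grading i (j + l)
  generated : ∀ i, Submodule.span (Unitization k A) (grading i i : Set (P i)) = ⊤
  d : ∀ i, P (i + 1) →ₗ[Unitization k A] P i
  d_mem : ∀ i j, ∀ x ∈ grading (i + 1) j, d i x ∈ grading i j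
  augmentation : P 0 →ₗ[Unitization k A] S
  augmentation_eq_zero : ∀ j, j ≠ 0 → ∀ x ∈ grading 0 j, augmentation x = 0
  augmentation_surjective : Function.Surjective augmentation
  exact_zero : Function.Exact (d 0) augmentation
  exact_succ : ∀ i, Function.Exact (d (i + 1)) (d i)

/-- Koszulity of a graded locally unital algebra `A = ⨁ e_i A e_j`: it is graded by the natural
numbers, its component of degree zero is the semisimple algebra `⨁ k e_i`, and every simple module
concentrated in degree zero has a linear graded projective resolution. -/
structure IsKoszulAlgebra {k A : Type u} [Field k] [NonUnitalRing A] [Module k A]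
    [IsScalarTower k A A] [SMulCommClass k A A] {ι : Type v} [DecidableEq ι] (e : ι → A)
    (𝒜 : ℕ → Submodule k A) : Prop where
  ne_zero : ∀ i, e i ≠ 0
  idempotent : ∀ i, e i * e i = e i
  orthogonal : ∀ i j, i ≠ j → e i * e j = 0
  peirce : DirectSum.IsInternal fun p : ι × ι =>
    LinearMap.range (LinearMap.mulLeft k (e p.1) ∘ₗ LinearMap.mulRight k (e p.2))
  isInternal : DirectSum.IsInternal 𝒜
  mul_mem : ∀ i j, ∀ a ∈ 𝒜 i, ∀ b ∈ 𝒜 j, a * b ∈ 𝒜 (i + j)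
  degree_zero : 𝒜 0 = Submodule.span k (Set.range e)
  linear : ∀ (S : Type w) [AddCommGroup S] [Module k S] [Module (Unitization k A) S]
    [IsScalarTower k (Unitization k A) S], IsSimpleModule (Unitization k A) S →
    IsLocallyUnital (k := k) e S →
    (∀ i, i ≠ 0 → ∀ a ∈ 𝒜 i, ∀ s : S, (a : Unitization k A) • s = 0) →
    Nonempty (LinearResolution (k := k) e 𝒜 S)

/-! ### The simple modules over the algebra of slarcs -/

/-- The one-dimensional module `L_n = k 1_n`, on which `1_n` acts as the identity and every other
diagram acts by zero. -/
def SlarcSimple (k : Type u) [Field k] (_n : ℕ) : Type u := k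

namespace SlarcSimple

noncomputable section

variable (k : Type u) [Field k] (n : ℕ)

instance : AddCommGroup (SlarcSimple k n) := inferInstanceAs (AddCommGroup k)

instance : Module k (SlarcSimple k n) := inferInstanceAs (Module k k)

instance : Module (Unitization k (SlarcAlgebra k)) (SlarcSimple k n) :=
  Module.compHom k (Unitization.lift (SlarcAlgebra.coeffOne k n)).toRingHom

lemma smul_def (a : Unitization k (SlarcAlgebra k)) (s : SlarcSimple k n) :
    a • s = (Unitization.lift (SlarcAlgebra.coeffOne k n) a : k) • s := rfl

instance : IsScalarTower k (Unitization k (SlarcAlgebra k)) (SlarcSimple k n) where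
  smul_assoc c a s := by
    rw [smul_def, smul_def, map_smul, smul_assoc]

end

end SlarcSimple

/-! Every `L_n` has an explicit linear resolution with an explicit contraction, and every simple
module is some `L_n`. The grading statements reduce to counting arcs: in a non-zero product the long
arcs meeting the middle line cover it, so short arcs add up (`numSarcs_concat`), and a diagram
without short arcs is an identity.

Fix `n`. A basis vector of `P^i` is a word read along the right line of a diagram. Each letter is a
long arc from a left point or a short arc; exactly `n` letters are distinguished, and a short arc
may be marked. The homological degree counts the letters that are not distinguished plus the marked
short arcs. Deleting the marked short arcs leaves a diagram on which `A^-` acts freely from the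
left, so `P^i` is a direct sum of modules `A^- 1_r`, generated by the words whose diagram is an
identity.

The differential is the signed derivation that erases a long arc that is not distinguished or
unmarks a marked short arc. In the diagram, the first operation creates one left short arc and the
second one right short arc, so the complex is linear. It commutes with the action of diagrams
(`actLin_diffWord`). The delicate case is a diagram that cuts a long arc that is not distinguished:
the cut letter has zero differential, and erasing the arc beforehand leaves a floating arc, so the
product is zero as well.

Exactness is checked over `k`, for each number `m` of left points. The differential neither creates
nor removes short-arc letters, so the complex splits in two. On words with a short arc, marking the
first one is a contraction (`diff_mark_add`). On words without short arcs each left point is,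
independently, absent, joined by an ordinary arc, or joined by a distinguished one; the first two
options cancel (`diff_insert_add`). Only the word with all `m` points distinguished survives, which
forces `m = n` and degree `0`: the homology is `L_n`.

For a simple `S`, take the least `n` with `1_n S ≠ 0`. A non-identity diagram from `n` to `n` points
factors through fewer points, so it kills `1_n S`. Simplicity then shows that diagrams with more
than `n` left points also kill a non-zero vector of `1_n S`, and this vector spans a copy of `L_n`
(`exists_vector_of_isSimpleModule`). -/

namespace SlarcDiagram

/-! ### Counting arcs and factoring diagrams. -/

lemma card_larcs_add_card_leftSarcs (x : SlarcDiagram) :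
    x.larcs.card + x.leftSarcs.card = x.left := by
  classical
  have h1 : (x.larcs.image Prod.fst).card = x.larcs.card :=
    Finset.card_image_of_injOn fun p hp q hq h =>
      Prod.ext h (x.larc_eq_left hp (by rw [h]; exact hq))
  have h2 : x.leftSarcs = Finset.range x.left \ x.larcs.image Prod.fst := by
    ext i
    simp [leftSarcs]
    grind
  have h3 : x.larcs.image Prod.fst ⊆ Finset.range x.left := by
    intro i hi
    obtain ⟨p, hp, rfl⟩ := Finset.mem_image.1 hi
    exact Finset.mem_range.2 (x.left_lt p hp)
  have := Finset.card_sdiff_add_card_eq_card h3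
  rw [h2, ← h1]
  simp at this
  omega

lemma card_larcs_add_card_rightSarcs (x : SlarcDiagram) :
    x.larcs.card + x.rightSarcs.card = x.right := by
  classical
  have h1 : (x.larcs.image Prod.snd).card = x.larcs.card :=
    Finset.card_image_of_injOn fun p hp q hq h =>
      Prod.ext (x.larc_eq_right hp (by rw [h]; exact hq)) h
  have h2 : x.rightSarcs = Finset.range x.right \ x.larcs.image Prod.snd := by
    ext i
    simp [rightSarcs]
    grind
  have h3 : x.larcs.image Prod.snd ⊆ Finset.range x.right := by
    intro i hi
    obtain ⟨p, hp, rfl⟩ := Finset.mem_image.1 hi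
    exact Finset.mem_range.2 (x.right_lt p hp)
  have := Finset.card_sdiff_add_card_eq_card h3
  rw [h2, ← h1]
  simp at this
  omega

lemma numSarcs_add (x : SlarcDiagram) : x.numSarcs + 2 * x.larcs.card = x.left + x.right := by
  have h1 := x.card_larcs_add_card_leftSarcs
  have h2 := x.card_larcs_add_card_rightSarcs
  unfold numSarcs
  omega

/-- Inclusion–exclusion on the common line: the ends of the long arcs of `x` and of `y` together
cover it, and the points in both sets correspond to the long arcs of the concatenation. -/
lemma card_larcs_concat {x y : SlarcDiagram} (h : Composable x y) :
    (concat x y).larcs.card + y.left = x.larcs.card + y.larcs.card := by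
  classical
  have hX : (x.larcs.image Prod.snd).card = x.larcs.card :=
    Finset.card_image_of_injOn fun p hp q hq h =>
      Prod.ext (x.larc_eq_right hp (by rw [h]; exact hq)) h
  have hY : (y.larcs.image Prod.fst).card = y.larcs.card :=
    Finset.card_image_of_injOn fun p hp q hq h =>
      Prod.ext h (y.larc_eq_left hp (by rw [h]; exact hq))
  have hu : x.larcs.image Prod.snd ∪ y.larcs.image Prod.fst = Finset.range y.left := by
    obtain ⟨h1, h2⟩ := composable_iff.1 h
    ext l
    simp only [Finset.mem_union, Finset.mem_image, Prod.exists, exists_eq_right, Finset.mem_range]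
    constructor
    · rintro (⟨i, hi⟩ | ⟨i, j, hj, rfl⟩)
      · exact h1 ▸ x.right_lt _ hi
      · exact y.left_lt _ hj
    · intro hl
      rcases h2 l hl with hi | ⟨j, hj⟩
      · exact Or.inl hi
      · exact Or.inr ⟨l, j, hj, rfl⟩
  have hi : (x.larcs.image Prod.snd ∩ y.larcs.image Prod.fst).card = (concat x y).larcs.card := by
    symm
    have key : ∀ p ∈ (concat x y).larcs, ∃ l, (p.1, l) ∈ x.larcs ∧ (l, p.2) ∈ y.larcs :=
      fun p hp => mem_concat.1 hp
    choose! f hf1 hf2 using key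
    refine Finset.card_bij (fun p _ => f p) ?_ ?_ ?_
    · intro p hp
      simp only [Finset.mem_inter, Finset.mem_image]
      exact ⟨⟨_, hf1 p hp, rfl⟩, ⟨_, hf2 p hp, rfl⟩⟩
    · intro p hp q hq e
      have e' : f p = f q := e
      have h1 := hf1 p hp
      have h2 := hf2 p hp
      rw [e'] at h1 h2
      exact Prod.ext (x.larc_eq_right h1 (hf1 q hq)) (y.larc_eq_left h2 (hf2 q hq))
    · intro l hl
      simp only [Finset.mem_inter, Finset.mem_image, Prod.exists, exists_eq_right] at hl
      obtain ⟨⟨i, hi⟩, a, j, hj, rfl⟩ := hl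
      have hm : (i, j) ∈ (concat x y).larcs := mem_concat.2 ⟨a, hi, hj⟩
      exact ⟨(i, j), hm, x.larc_eq_left (hf1 _ hm) hi⟩
  have := Finset.card_union_add_card_inter (x.larcs.image Prod.snd) (y.larcs.image Prod.fst)
  rw [hu, hi, hX, hY, Finset.card_range] at this
  omega

/-- The number of short arcs is the number of boundary points minus twice the number of long arcs,
so `card_larcs_concat` is exactly the additivity needed. This makes the algebra graded. -/
lemma numSarcs_concat {x y : SlarcDiagram} (h : Composable x y) :
    (concat x y).numSarcs = x.numSarcs + y.numSarcs := by
  have h0 := card_larcs_concat h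
  have h1 := x.numSarcs_add
  have h2 := y.numSarcs_add
  have h3 := (concat x y).numSarcs_add
  have h4 : (concat x y).left = x.left := rfl
  have h5 : (concat x y).right = y.right := rfl
  have h6 := h.1
  omega

/-- A diagram in which all right points end long arcs and which has as many left as right points
has no short arcs. -/
lemma eq_one_of_forall_right {x : SlarcDiagram} (hlr : x.left = x.right)
    (h : ∀ j < x.right, ∃ i, (i, j) ∈ x.larcs) : x = one x.right := by
  choose! f hf using h
  have hmono : ∀ i < x.right, ∀ j < x.right, i < j → f i < f j := fun i hi j hj hij =>
    (x.planar _ (hf i hi) _ (hf j hj)).2 hij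
  have hge : ∀ j < x.right, j ≤ f j := by
    intro j
    induction j with
    | zero => intro _; exact Nat.zero_le _
    | succ j ih =>
      intro hj
      have := ih (by omega)
      have := hmono j (by omega) (j + 1) hj (by omega)
      omega
  -- The upper bound is proved by induction on the distance `d` from the topmost point, mirroring
  -- the upward induction for `hge`.
  have hle : ∀ d j, j + d + 1 = x.right → f j ≤ j := by
    intro d
    induction d with
    | zero =>
      intro j hj
      have := x.left_lt _ (hf j (by omega))
      simp only at this
      omega
    | succ d ih =>
      intro j hj
      have := ih (j + 1) (by omega)
      have := hmono j (by omega) (j + 1) (by omega) (by omega)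
      omega
  have hid : ∀ j < x.right, f j = j := fun j hj =>
    le_antisymm (hle (x.right - j - 1) j (by omega)) (hge j hj)
  ext1
  · exact hlr
  · rfl
  · ext ⟨i, j⟩
    rw [mem_one]
    constructor
    · intro hij
      have hj : j < x.right := x.right_lt _ hij
      have e : i = j := by
        rw [← hid j hj]; exact x.larc_eq_right hij (hf j hj)
      exact ⟨e, e ▸ hj⟩
    · rintro ⟨rfl, hi⟩
      have := hf i hi
      rwa [hid i hi] at this

lemma exists_larc_of_rightSarcs_eq_empty {x : SlarcDiagram} (h : x.rightSarcs = ∅) :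
    ∀ j < x.right, ∃ i, (i, j) ∈ x.larcs := by
  intro j hj
  by_contra hc
  push Not at hc
  have : j ∈ x.rightSarcs := by
    simp only [rightSarcs, Finset.mem_filter, Finset.mem_range]
    exact ⟨hj, fun p hp e => hc p.1 (e ▸ hp)⟩
  simp [h] at this

lemma eq_one_of_numSarcs_eq_zero {x : SlarcDiagram} (h : x.numSarcs = 0) : x = one x.right := by
  have h1 := x.card_larcs_add_card_leftSarcs
  have h2 := x.card_larcs_add_card_rightSarcs
  unfold numSarcs at h
  exact eq_one_of_forall_right (by omega)
    (exists_larc_of_rightSarcs_eq_empty (Finset.card_eq_zero.1 (by omega)))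

@[simp] lemma numSarcs_one (n : ℕ) : (one n).numSarcs = 0 := by
  have h := (one n).numSarcs_add
  have h1 : (one n).larcs.card = n := by
    rw [one, Finset.card_image_of_injective _ fun a b h => (Prod.ext_iff.1 h).1,
      Finset.card_range]
  have h2 : (one n).left = n := rfl
  have h3 : (one n).right = n := rfl
  omega

lemma one_composable {n : ℕ} {x : SlarcDiagram} : Composable (one n) x ↔ n = x.left := by
  rw [composable_iff]
  constructor
  · exact fun h => h.1
  · rintro rfl
    exact ⟨rfl, fun l hl => Or.inl ⟨l, mem_one.2 ⟨rfl, hl⟩⟩⟩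

lemma composable_one {n : ℕ} {x : SlarcDiagram} : Composable x (one n) ↔ x.right = n := by
  rw [composable_iff]
  constructor
  · exact fun h => h.1
  · rintro rfl
    exact ⟨rfl, fun l hl => Or.inr ⟨l, mem_one.2 ⟨rfl, hl⟩⟩⟩

lemma one_concat (x : SlarcDiagram) : concat (one x.left) x = x := by
  ext1
  · rfl
  · rfl
  · ext ⟨i, j⟩
    simp only [mem_concat, mem_one]
    constructor
    · rintro ⟨l, ⟨rfl, -⟩, h⟩
      exact h
    · exact fun h => ⟨i, ⟨rfl, x.left_lt _ h⟩, h⟩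

lemma concat_one (x : SlarcDiagram) : concat x (one x.right) = x := by
  ext1
  · rfl
  · rfl
  · ext ⟨i, j⟩
    simp only [mem_concat, mem_one]
    constructor
    · rintro ⟨l, h, ⟨rfl, -⟩⟩
      exact h
    · exact fun h => ⟨j, h, ⟨rfl, x.right_lt _ h⟩⟩

/-- A diagram with a short arc at the right factors through a smaller number of points. -/
lemma exists_eq_concat {x : SlarcDiagram} (h : x.rightSarcs.Nonempty) :
    ∃ y z : SlarcDiagram, Composable y z ∧ concat y z = x ∧ z.left < x.right := by
  obtain ⟨s, hs⟩ := h
  simp only [rightSarcs, Finset.mem_filter, Finset.mem_range] at hs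
  obtain ⟨hs, hs'⟩ := hs
  -- `δ` is the increasing injection that skips the short arc `s`. The factor `y` is `x` with `s`
  -- deleted, and `z` is the diagram whose only short arc is the right one at `s`.
  let δ : ℕ → ℕ := fun c => if c < s then c else c + 1
  have hδ : ∀ a b, δ a < δ b ↔ a < b := by
    intro a b
    simp only [δ]
    split_ifs <;> omega
  have hδ' : ∀ a, δ a < x.right ↔ a < x.right - 1 := by
    intro a
    simp only [δ]
    split_ifs <;> omega
  have hsurj : ∀ j, j ≠ s → ∃ c, δ c = j := by
    intro j hj
    by_cases hjs : j < s
    · exact ⟨j, by simp [δ, hjs]⟩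
    · exact ⟨j - 1, by simp only [δ]; split_ifs <;> omega⟩
  let y : SlarcDiagram :=
    { left := x.left
      right := x.right - 1
      larcs := (Finset.range x.left ×ˢ Finset.range (x.right - 1)).filter
        fun p => (p.1, δ p.2) ∈ x.larcs
      left_lt := by simp; omega
      right_lt := fun p hp =>
        Finset.mem_range.1 (Finset.mem_product.1 (Finset.mem_filter.1 hp).1).2
      planar := by
        intro p hp q hq
        rw [← hδ p.2 q.2]
        exact x.planar _ (Finset.mem_filter.1 hp).2 _ (Finset.mem_filter.1 hq).2 }
  let z : SlarcDiagram :=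
    { left := x.right - 1
      right := x.right
      larcs := (Finset.range (x.right - 1)).image fun c => (c, δ c)
      left_lt := by simp
      right_lt := by simpa using fun a ha => (hδ' a).2 ha
      planar := by
        intro p hp q hq
        obtain ⟨a, -, rfl⟩ := Finset.mem_image.1 hp
        obtain ⟨b, -, rfl⟩ := Finset.mem_image.1 hq
        exact (hδ a b).symm }
  have hy : ∀ i j, (i, j) ∈ y.larcs ↔ (i, δ j) ∈ x.larcs := by
    intro i j
    simp only [y, Finset.mem_filter, Finset.mem_product, Finset.mem_range, and_iff_right_iff_imp]
    exact fun h => ⟨x.left_lt _ h, (hδ' j).1 (x.right_lt _ h)⟩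
  have hz : ∀ i j, (i, j) ∈ z.larcs ↔ i < x.right - 1 ∧ δ i = j := by
    intro i j
    simp only [z, Finset.mem_image, Finset.mem_range, Prod.mk.injEq]
    constructor
    · rintro ⟨a, h, rfl, rfl⟩
      exact ⟨h, rfl⟩
    · rintro ⟨h, rfl⟩
      exact ⟨i, h, rfl, rfl⟩
  refine ⟨y, z, composable_iff.2 ⟨rfl, fun l hl => Or.inr ⟨δ l, (hz _ _).2 ⟨hl, rfl⟩⟩⟩, ?_, ?_⟩
  · ext1
    · rfl
    · rfl
    · ext ⟨i, j⟩
      rw [mem_concat]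
      constructor
      · rintro ⟨l, h1, h2⟩
        obtain ⟨-, rfl⟩ := (hz _ _).1 h2
        exact (hy _ _).1 h1
      · intro h
        obtain ⟨c, rfl⟩ := hsurj j (hs' _ h)
        exact ⟨c, (hy _ _).2 h, (hz _ _).2 ⟨(hδ' c).1 (x.right_lt _ h), rfl⟩⟩
  · change x.right - 1 < x.right
    omega

end SlarcDiagram

/-! ### Direct sums given by partitions of a basis. -/

section Basis

variable {k : Type u} [Field k] {M : Type v} [AddCommGroup M] [Module k M] {X : Type w}
  {κ : Type*}

/-- A partition of a basis decomposes the space into the direct sum of the spans of the parts. -/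
lemma Module.Basis.isInternal_span_fiber [DecidableEq κ] (b : Module.Basis X k M) (f : X → κ) :
    DirectSum.IsInternal fun j => Submodule.span k (b '' {x | f x = j}) := by
  apply DirectSum.isInternal_submodule_of_iSupIndep_of_iSup_eq_top
  · intro j
    have h : (⨆ i, ⨆ (_ : i ≠ j), Submodule.span k (b '' {x | f x = i})) ≤
        Submodule.span k (b '' {x | f x ≠ j}) := by
      refine iSup₂_le fun i hi => Submodule.span_mono (Set.image_mono ?_)
      rintro x rfl
      exact hi
    refine Disjoint.mono_right h (b.linearIndependent.disjoint_span_image ?_)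
    rw [Set.disjoint_left]
    exact fun x h1 h2 => h2 h1
  · rw [eq_top_iff, ← b.span_eq, Submodule.span_le]
    rintro _ ⟨x, rfl⟩
    exact Submodule.mem_iSup_of_mem (f x) (Submodule.subset_span ⟨x, rfl, rfl⟩)

/-- An operator that keeps one block of a basis and kills the rest has that block as image. This is
how the idempotents `1_n` act, so Peirce components and the subspaces `1_n M` become spans of basis
vectors. -/
lemma Module.Basis.range_eq_span_fiber [DecidableEq κ] (b : Module.Basis X k M) (f : X → κ)
    (j : κ) (T : M →ₗ[k] M) (hT : ∀ x, T (b x) = if f x = j then b x else 0) :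
    LinearMap.range T = Submodule.span k (b '' {x | f x = j}) := by
  rw [LinearMap.range_eq_map, ← b.span_eq, Submodule.map_span]
  apply le_antisymm
  · rw [Submodule.span_le]
    rintro _ ⟨_, ⟨x, rfl⟩, rfl⟩
    rw [hT]
    split_ifs with h
    · exact Submodule.subset_span ⟨x, h, rfl⟩
    · exact Submodule.zero_mem _
  · refine Submodule.span_mono ?_
    rintro _ ⟨x, hx, rfl⟩
    exact ⟨b x, ⟨x, rfl⟩, by rw [hT]; exact if_pos hx⟩

end Basis

/-! ### The grading and the Peirce decomposition of the algebra. -/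

namespace SlarcAlgebra

variable (k : Type u) [Field k]

lemma diag_mul_diag_of_composable {x y : SlarcDiagram} (h : x.Composable y) :
    diag k x * diag k y = diag k (x.concat y) := by
  rw [diag_mul_diag, diagMul, if_pos h]

lemma diag_mul_diag_of_not_composable {x y : SlarcDiagram} (h : ¬ x.Composable y) :
    diag k x * diag k y = 0 := by
  rw [diag_mul_diag, diagMul, if_neg h]

lemma idem_mul_diag (n : ℕ) (x : SlarcDiagram) :
    idem k n * diag k x = if x.left = n then diag k x else 0 := by
  split_ifs with h
  · subst h
    rw [idem, diag_mul_diag_of_composable k (SlarcDiagram.one_composable.2 rfl),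
      SlarcDiagram.one_concat]
  · exact diag_mul_diag_of_not_composable k fun hc => h (SlarcDiagram.one_composable.1 hc).symm

lemma diag_mul_idem (n : ℕ) (x : SlarcDiagram) :
    diag k x * idem k n = if x.right = n then diag k x else 0 := by
  split_ifs with h
  · subst h
    rw [idem, diag_mul_diag_of_composable k (SlarcDiagram.composable_one.2 rfl),
      SlarcDiagram.concat_one]
  · exact diag_mul_diag_of_not_composable k fun hc => h (SlarcDiagram.composable_one.1 hc)

lemma diag_ne_zero (x : SlarcDiagram) : diag k x ≠ 0 := (basis k).ne_zero x

lemma sarcGrading_isInternal : DirectSum.IsInternal (sarcGrading k) :=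
  (basis k).isInternal_span_fiber SlarcDiagram.numSarcs

lemma peirce_isInternal : DirectSum.IsInternal fun p : ℕ × ℕ =>
    LinearMap.range (LinearMap.mulLeft k (idem k p.1) ∘ₗ LinearMap.mulRight k (idem k p.2)) := by
  have key : (fun p : ℕ × ℕ => LinearMap.range
      (LinearMap.mulLeft k (idem k p.1) ∘ₗ LinearMap.mulRight k (idem k p.2))) =
      fun p => Submodule.span k (basis k '' {x | (x.left, x.right) = p}) := by
    funext p
    refine (basis k).range_eq_span_fiber (fun x => (x.left, x.right)) p _ fun x => ?_
    change idem k p.1 * (diag k x * idem k p.2) = if _ then diag k x else 0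
    obtain ⟨m, n⟩ := p
    rw [diag_mul_idem]
    by_cases h : x.right = n
    · rw [if_pos h, idem_mul_diag]
      simp [h]
    · simp [h]
  rw [key]
  exact (basis k).isInternal_span_fiber fun x => (x.left, x.right)

lemma mul_mem_sarcGrading (i j : ℕ) (a : SlarcAlgebra k) (ha : a ∈ sarcGrading k i)
    (b : SlarcAlgebra k) (hb : b ∈ sarcGrading k j) : a * b ∈ sarcGrading k (i + j) := by
  induction ha using Submodule.span_induction with
  | zero => rw [zero_mul]; exact Submodule.zero_mem _
  | add a a' _ _ h h' => rw [add_mul]; exact Submodule.add_mem _ h h'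
  | smul c a _ h => rw [smul_mul_assoc]; exact Submodule.smul_mem _ _ h
  | mem a ha =>
    obtain ⟨x, rfl, rfl⟩ := ha
    induction hb using Submodule.span_induction with
    | zero => rw [mul_zero]; exact Submodule.zero_mem _
    | add a a' _ _ h h' => rw [mul_add]; exact Submodule.add_mem _ h h'
    | smul c a _ h => rw [mul_smul_comm]; exact Submodule.smul_mem _ _ h
    | mem b hb =>
      obtain ⟨y, rfl, rfl⟩ := hb
      by_cases h : x.Composable y
      · rw [diag_mul_diag_of_composable k h]
        exact Submodule.subset_span ⟨_, SlarcDiagram.numSarcs_concat h, rfl⟩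
      · rw [diag_mul_diag_of_not_composable k h]
        exact Submodule.zero_mem _

lemma sarcGrading_zero : sarcGrading k 0 = Submodule.span k (Set.range (idem k)) := by
  have h : diag k '' {x | x.numSarcs = 0} = Set.range (idem k) := by
    ext a
    constructor
    · rintro ⟨x, hx, rfl⟩
      exact ⟨x.right, by rw [idem, ← SlarcDiagram.eq_one_of_numSarcs_eq_zero hx]⟩
    · rintro ⟨n, rfl⟩
      exact ⟨_, SlarcDiagram.numSarcs_one n, rfl⟩
  rw [sarcGrading, h]

lemma coeffOne_diag [DecidableEq SlarcDiagram] (n : ℕ) (x : SlarcDiagram) :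
    coeffOne k n (diag k x) = if x = SlarcDiagram.one n then 1 else 0 := by
  change (basis k).coord (SlarcDiagram.one n) (basis k x) = _
  rw [Module.Basis.coord_apply, Module.Basis.repr_self, Finsupp.single_apply]

end SlarcAlgebra

open SlarcDiagram

/-! ### Projective modules from free actions of diagrams. -/

section Unitization

variable {k : Type u} [Field k]

/-- A `k`-linear map that commutes with all diagrams is a homomorphism of modules over the algebra
of slarcs. -/
def LinearMap.ofCommDiag {M : Type v} {N : Type w} [AddCommGroup M] [Module k M]
    [Module (Unitization k (SlarcAlgebra k)) M] [IsScalarTower k (Unitization k (SlarcAlgebra k)) M]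
    [AddCommGroup N] [Module k N] [Module (Unitization k (SlarcAlgebra k)) N]
    [IsScalarTower k (Unitization k (SlarcAlgebra k)) N] (f : M →ₗ[k] N)
    (hf : ∀ x q, f ((SlarcAlgebra.diag k x : Unitization k (SlarcAlgebra k)) • q) =
      (SlarcAlgebra.diag k x : Unitization k (SlarcAlgebra k)) • f q) :
    M →ₗ[Unitization k (SlarcAlgebra k)] N where
  toFun := f
  map_add' := map_add f
  map_smul' := by
    intro a q
    rw [RingHom.id_apply]
    induction a using Unitization.ind with
    | inl_add_inr c a =>
      have h1 : f ((Unitization.inl c : Unitization k (SlarcAlgebra k)) • q) =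
          (Unitization.inl c : Unitization k (SlarcAlgebra k)) • f q := by
        rw [← Unitization.algebraMap_eq_inl, algebraMap_smul, algebraMap_smul, map_smul]
      have h2 : f ((a : Unitization k (SlarcAlgebra k)) • q) =
          (a : Unitization k (SlarcAlgebra k)) • f q := by
        induction a using SlarcAlgebra.diag_induction with
        | hd x => exact hf x q
        | h0 => simp
        | ha a b ha hb => rw [Unitization.inr_add, add_smul, add_smul, map_add, ha, hb]
        | hs c a h => rw [Unitization.inr_smul, smul_assoc, smul_assoc, map_smul, h]
      rw [add_smul, add_smul, map_add, h1, h2]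

@[simp] lemma LinearMap.ofCommDiag_apply {M : Type v} {N : Type w} [AddCommGroup M] [Module k M]
    [Module (Unitization k (SlarcAlgebra k)) M] [IsScalarTower k (Unitization k (SlarcAlgebra k)) M]
    [AddCommGroup N] [Module k N] [Module (Unitization k (SlarcAlgebra k)) N]
    [IsScalarTower k (Unitization k (SlarcAlgebra k)) N] (f : M →ₗ[k] N)
    (hf : ∀ x q, f ((SlarcAlgebra.diag k x : Unitization k (SlarcAlgebra k)) • q) =
      (SlarcAlgebra.diag k x : Unitization k (SlarcAlgebra k)) • f q) (q : M) :
    LinearMap.ofCommDiag f hf q = f q := rfl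

end Unitization

/-- A set on which diagrams act freely: each element is obtained in a unique way by letting
a diagram, `diagram w`, act on a generator, `gen w`. The value of `act x w` only matters if
`x` and `diagram w` are composable. -/
class DiagramSet (X : Type) where
  diagram : X → SlarcDiagram
  act : SlarcDiagram → X → X
  gen : X → X
  diagram_act : ∀ {x w}, Composable x (diagram w) → diagram (act x w) = concat x (diagram w)
  act_act : ∀ {x y w}, Composable y (diagram w) → act x (act y w) = act (concat x y) w
  gen_act : ∀ {x w}, Composable x (diagram w) → gen (act x w) = gen w
  diagram_gen : ∀ w, diagram (gen w) = one (diagram w).right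
  act_gen : ∀ w, act (diagram w) (gen w) = w

/-- The vector space with basis a set on which diagrams act, a module over the algebra of slarcs. -/
def DiagramModule (k : Type u) [Field k] (X : Type) : Type u := X →₀ k

namespace DiagramModule

open DiagramSet

noncomputable section

variable (k : Type u) [Field k] (X : Type)

instance : AddCommGroup (DiagramModule k X) := inferInstanceAs (AddCommGroup (X →₀ k))

instance : Module k (DiagramModule k X) := inferInstanceAs (Module k (X →₀ k))

/-- The basis of a diagram module. -/
def basis : Module.Basis X k (DiagramModule k X) :=
  Module.Basis.ofRepr (LinearEquiv.refl k (X →₀ k))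

variable {X} [DiagramSet X]

open Classical in
/-- The action of a diagram on basis vectors. -/
def actBasis (x : SlarcDiagram) (w : X) : DiagramModule k X :=
  if Composable x (diagram w) then basis k X (act x w) else 0

variable (X) in
/-- The action of the algebra of slarcs as a bilinear map. -/
def actBilin : SlarcAlgebra k →ₗ[k] Module.End k (DiagramModule k X) :=
  (SlarcAlgebra.basis k).constr k fun x => (basis k X).constr k fun w => actBasis k x w

lemma actBilin_diag_basis (x : SlarcDiagram) (w : X) :
    actBilin k X (SlarcAlgebra.diag k x) (basis k X w) = actBasis k x w := by
  rw [actBilin, SlarcAlgebra.diag, Module.Basis.constr_basis, Module.Basis.constr_basis]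

lemma composable_act {x y : SlarcDiagram} {w : X} (h : Composable y (diagram w)) :
    Composable x (diagram (act y w)) ↔ Composable x y ∧ Composable (concat x y) (diagram w) := by
  rw [diagram_act h]
  have := composable_assoc x y (diagram w)
  tauto

/-- Unitality is not an axiom of `DiagramSet`: it follows by writing `w` as its diagram acting on
its generator and absorbing the identity into the diagram. -/
lemma act_one (w : X) : act (one (diagram w).left) w = w := by
  have h : Composable (diagram w) (diagram (gen w)) := by
    rw [diagram_gen]
    exact composable_one.2 rfl
  conv_lhs => rw [← act_gen w, act_act h, act_gen, one_concat]
  exact act_gen w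

variable (X) in
/-- The action of the algebra of slarcs on a diagram module. -/
def actHom : SlarcAlgebra k →ₙₐ[k] Module.End k (DiagramModule k X) :=
  { actBilin k X with
    map_zero' := map_zero (actBilin k X)
    map_mul' := by
      intro a b
      change actBilin k X (a * b) = actBilin k X a * actBilin k X b
      induction a using SlarcAlgebra.diag_induction with
      | h0 => simp only [zero_mul, map_zero]
      | ha a b h1 h2 => simp only [add_mul, map_add, h1, h2]
      | hs c a h => rw [smul_mul_assoc, map_smul, map_smul, h, smul_mul_assoc]
      | hd x =>
        induction b using SlarcAlgebra.diag_induction with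
        | h0 => simp only [mul_zero, map_zero]
        | ha a b h1 h2 => simp only [mul_add, map_add, h1, h2]
        | hs c a h => rw [mul_smul_comm, map_smul, map_smul, h, mul_smul_comm]
        | hd y =>
          refine (basis k X).ext fun w => ?_
          rw [Module.End.mul_apply, actBilin_diag_basis, actBasis]
          by_cases hy : Composable y (diagram w)
          · rw [if_pos hy, actBilin_diag_basis, actBasis, composable_act hy, act_act hy]
            by_cases hx : Composable x y
            · rw [SlarcAlgebra.diag_mul_diag_of_composable k hx, actBilin_diag_basis, actBasis]
              by_cases hc : Composable (concat x y) (diagram w)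
              · rw [if_pos hc, if_pos ⟨hx, hc⟩]
              · rw [if_neg hc, if_neg fun h => hc h.2]
            · rw [SlarcAlgebra.diag_mul_diag_of_not_composable k hx, map_zero,
                LinearMap.zero_apply, if_neg fun h => hx h.1]
          · rw [if_neg hy, map_zero]
            by_cases hx : Composable x y
            · rw [SlarcAlgebra.diag_mul_diag_of_composable k hx, actBilin_diag_basis, actBasis,
                if_neg]
              -- By associativity of composability, `x y` could act on `w` only if `y` could; both
              -- sides are therefore zero.
              exact fun h => hy ((composable_assoc x y _).1 ⟨hx, h⟩).1
            · rw [SlarcAlgebra.diag_mul_diag_of_not_composable k hx, map_zero,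
                LinearMap.zero_apply] }

instance : Module (Unitization k (SlarcAlgebra k)) (DiagramModule k X) :=
  Module.compHom (DiagramModule k X) (Unitization.lift (actHom k X)).toRingHom

lemma smul_def (a : Unitization k (SlarcAlgebra k)) (q : DiagramModule k X) :
    a • q = (Unitization.lift (actHom k X) a : Module.End k (DiagramModule k X)) q := rfl

instance : IsScalarTower k (Unitization k (SlarcAlgebra k)) (DiagramModule k X) where
  smul_assoc c a q := by
    rw [smul_def, smul_def, map_smul, LinearMap.smul_apply]

lemma diag_smul_basis (x : SlarcDiagram) (w : X) :
    (SlarcAlgebra.diag k x : Unitization k (SlarcAlgebra k)) • basis k X w = actBasis k x w := by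
  rw [smul_def, ← Unitization.lift_symm_apply_apply, Equiv.symm_apply_apply]
  exact actBilin_diag_basis k x w

lemma diag_smul_basis_of_composable {x : SlarcDiagram} {w : X} (h : Composable x (diagram w)) :
    (SlarcAlgebra.diag k x : Unitization k (SlarcAlgebra k)) • basis k X w =
      basis k X (act x w) := by
  rw [diag_smul_basis, actBasis, if_pos h]

lemma diag_smul_basis_of_not_composable {x : SlarcDiagram} {w : X}
    (h : ¬ Composable x (diagram w)) :
    (SlarcAlgebra.diag k x : Unitization k (SlarcAlgebra k)) • basis k X w = 0 := by
  rw [diag_smul_basis, actBasis, if_neg h]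

lemma diagram_smul_gen (w : X) :
    (SlarcAlgebra.diag k (diagram w) : Unitization k (SlarcAlgebra k)) • basis k X (gen w) =
      basis k X w := by
  rw [diag_smul_basis_of_composable, act_gen]
  rw [diagram_gen]
  exact composable_one.2 rfl

variable {k} in
/-- To commute with diagrams, it is enough to do so on basis vectors. -/
lemma comm_diag_of_basis {N : Type v} [AddCommGroup N] [Module k N]
    [Module (Unitization k (SlarcAlgebra k)) N] [IsScalarTower k (Unitization k (SlarcAlgebra k)) N]
    (f : DiagramModule k X →ₗ[k] N) (x : SlarcDiagram)
    (h : ∀ w, f ((SlarcAlgebra.diag k x : Unitization k (SlarcAlgebra k)) • basis k X w) =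
      (SlarcAlgebra.diag k x : Unitization k (SlarcAlgebra k)) • f (basis k X w))
    (q : DiagramModule k X) :
    f ((SlarcAlgebra.diag k x : Unitization k (SlarcAlgebra k)) • q) =
      (SlarcAlgebra.diag k x : Unitization k (SlarcAlgebra k)) • f q := by
  have : f ∘ₗ Algebra.lsmul k k (DiagramModule k X)
        (SlarcAlgebra.diag k x : Unitization k (SlarcAlgebra k)) =
      Algebra.lsmul k k N (SlarcAlgebra.diag k x : Unitization k (SlarcAlgebra k)) ∘ₗ f :=
    (basis k X).ext h
  exact LinearMap.congr_fun this q

variable (X)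

lemma isLocallyUnital : IsLocallyUnital (k := k) (SlarcAlgebra.idem k) (DiagramModule k X) := by
  unfold IsLocallyUnital
  convert (basis k X).isInternal_span_fiber (fun w => (diagram w).left) using 1
  funext m
  refine (basis k X).range_eq_span_fiber (fun w => (diagram w).left) m _ fun w => ?_
  change (SlarcAlgebra.diag k (one m) : Unitization k (SlarcAlgebra k)) • basis k X w = _
  split_ifs with h
  · subst h
    rw [diag_smul_basis_of_composable k (one_composable.2 rfl), act_one]
  · exact diag_smul_basis_of_not_composable k fun hc => h (one_composable.1 hc).symm

/-- The `k`-linear map writing basis vectors as multiples of generators. -/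
def sectionAux : DiagramModule k X →ₗ[k] (DiagramModule k X →₀ Unitization k (SlarcAlgebra k)) :=
  (basis k X).constr k fun w => Finsupp.single (basis k X (gen w))
    (SlarcAlgebra.diag k (diagram w) : Unitization k (SlarcAlgebra k))

lemma sectionAux_basis (w : X) : sectionAux k X (basis k X w) =
    Finsupp.single (basis k X (gen w))
      (SlarcAlgebra.diag k (diagram w) : Unitization k (SlarcAlgebra k)) := by
  rw [sectionAux, Module.Basis.constr_basis]

/-- Freeness of the action gives a splitting: sending `w` to its diagram times the symbol of its
generator is linear over the algebra, since the action changes the diagram by left multiplication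
and leaves the generator unchanged. Evaluating the symbol returns `w`. -/
lemma projective : Module.Projective (Unitization k (SlarcAlgebra k)) (DiagramModule k X) := by
  have hs : ∀ x q, sectionAux k X
      ((SlarcAlgebra.diag k x : Unitization k (SlarcAlgebra k)) • q) =
      (SlarcAlgebra.diag k x : Unitization k (SlarcAlgebra k)) • sectionAux k X q := by
    intro x
    refine comm_diag_of_basis _ x fun w => ?_
    rw [sectionAux_basis, Finsupp.smul_single, smul_eq_mul, ← Unitization.inr_mul]
    by_cases h : Composable x (diagram w)
    · rw [diag_smul_basis_of_composable k h, sectionAux_basis, gen_act h, diagram_act h,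
        SlarcAlgebra.diag_mul_diag_of_composable k h]
    · rw [diag_smul_basis_of_not_composable k h, map_zero,
        SlarcAlgebra.diag_mul_diag_of_not_composable k h, Unitization.inr_zero, Finsupp.single_zero]
  refine ⟨⟨LinearMap.ofCommDiag (sectionAux k X) hs, fun q => ?_⟩⟩
  rw [LinearMap.ofCommDiag_apply]
  have : ((Finsupp.linearCombination (Unitization k (SlarcAlgebra k)) id).restrictScalars k :
      (DiagramModule k X →₀ Unitization k (SlarcAlgebra k)) →ₗ[k] DiagramModule k X) ∘ₗ
      sectionAux k X = LinearMap.id := by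
    refine (basis k X).ext fun w => ?_
    rw [LinearMap.comp_apply, sectionAux_basis, LinearMap.restrictScalars_apply,
      Finsupp.linearCombination_single, id, diagram_smul_gen, LinearMap.id_apply]
  exact LinearMap.congr_fun this q

/-- The grading of a diagram module by the number of short arcs of the diagram, with the generators
placed in degree `i`. -/
def grading (i j : ℕ) : Submodule k (DiagramModule k X) :=
  Submodule.span k (basis k X '' {w | i + (diagram w).numSarcs = j})

lemma grading_isInternal (i : ℕ) : DirectSum.IsInternal (grading k X i) :=
  (basis k X).isInternal_span_fiber fun w => i + (diagram w).numSarcs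

lemma smul_mem_grading (i j l : ℕ) (a : SlarcAlgebra k) (ha : a ∈ SlarcAlgebra.sarcGrading k j)
    (q : DiagramModule k X) (hq : q ∈ grading k X i l) :
    (a : Unitization k (SlarcAlgebra k)) • q ∈ grading k X i (j + l) := by
  induction ha using Submodule.span_induction with
  | zero => rw [Unitization.inr_zero, zero_smul]; exact Submodule.zero_mem _
  | add a a' _ _ h h' =>
    rw [Unitization.inr_add, add_smul]; exact Submodule.add_mem _ h h'
  | smul c a _ h => rw [Unitization.inr_smul, smul_assoc]; exact Submodule.smul_mem _ _ h
  | mem a ha =>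
    obtain ⟨x, rfl, rfl⟩ := ha
    induction hq using Submodule.span_induction with
    | zero => rw [smul_zero]; exact Submodule.zero_mem _
    | add a a' _ _ h h' => rw [smul_add]; exact Submodule.add_mem _ h h'
    | smul c a _ h =>
      -- Scalars are central in the unitization, which lets `c` move past the algebra element.
      rw [← algebraMap_smul (Unitization k (SlarcAlgebra k)) c a, ← mul_smul,
        ← Algebra.commutes, mul_smul, algebraMap_smul]
      exact Submodule.smul_mem _ _ h
    | mem b hb =>
      obtain ⟨w, rfl, rfl⟩ := hb
      by_cases h : Composable x (diagram w)
      · rw [diag_smul_basis_of_composable k h]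
        refine Submodule.subset_span ⟨_, ?_, rfl⟩
        rw [Set.mem_ofPred_eq, diagram_act h, numSarcs_concat h]
        omega
      · rw [diag_smul_basis_of_not_composable k h]
        exact Submodule.zero_mem _

/-- The diagram of a generator is an identity, with no short arcs, so all generators sit in degree
exactly `i`. -/
lemma span_grading (i : ℕ) :
    Submodule.span (Unitization k (SlarcAlgebra k)) (grading k X i i : Set (DiagramModule k X)) =
      ⊤ := by
  have h : (⊤ : Submodule k (DiagramModule k X)) ≤ (Submodule.span (Unitization k (SlarcAlgebra k))
      (grading k X i i : Set (DiagramModule k X))).restrictScalars k := by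
    rw [← (basis k X).span_eq, Submodule.span_le]
    rintro _ ⟨w, rfl⟩
    rw [← diagram_smul_gen]
    refine Submodule.smul_mem _ _ (Submodule.subset_span ?_)
    refine Submodule.subset_span ⟨_, ?_, rfl⟩
    rw [Set.mem_ofPred_eq, diagram_gen, numSarcs_one, add_zero]
  exact eq_top_iff.2 fun q _ => h (Submodule.mem_top (x := q))

end

end DiagramModule

/-! ### Words encoding the bases of the resolution. -/

/-- A right point of a diagram together with two marks. A point is the end of the long arc from the
left point `a`, or of a short arc; `f` tells whether it is one of the `n` distinguished points, and
`s` whether the short arc is a marked one. -/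
inductive SlarcLetter
  | larc (f : Bool) (a : ℕ)
  | sarc (f : Bool) (s : Bool)

namespace SlarcLetter

/-- The contribution of a letter to the homological degree. -/
def degree : SlarcLetter → ℕ
  | larc f _ => cond f 0 1
  | sarc f s => cond f 0 1 + cond s 1 0

/-- The number of distinguished points of a letter. -/
def numDist : SlarcLetter → ℕ
  | larc f _ => cond f 1 0
  | sarc f _ => cond f 1 0

open Classical in
/-- The action of a diagram on a letter. -/
noncomputable def subst (x : SlarcDiagram) : SlarcLetter → SlarcLetter
  | larc f b => if h : ∃ i, (i, b) ∈ x.larcs then larc f h.choose else sarc f false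
  | sarc f s => sarc f s

lemma subst_of_mem {x : SlarcDiagram} {i b : ℕ} (h : (i, b) ∈ x.larcs) (f : Bool) :
    subst x (larc f b) = larc f i := by
  have h' : ∃ i, (i, b) ∈ x.larcs := ⟨i, h⟩
  rw [subst, dif_pos h', x.larc_eq_right h'.choose_spec h]

lemma subst_of_forall_notMem {x : SlarcDiagram} {b : ℕ} (h : ¬ ∃ i, (i, b) ∈ x.larcs) (f : Bool) :
    subst x (larc f b) = sarc f false := by
  rw [subst, dif_neg h]

@[simp] lemma subst_sarc (x : SlarcDiagram) (f s : Bool) : subst x (sarc f s) = sarc f s := rfl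

@[simp] lemma degree_subst (x : SlarcDiagram) (l : SlarcLetter) :
    (subst x l).degree = l.degree := by
  cases l with
  | sarc f s => rfl
  | larc f b =>
    by_cases h : ∃ i, (i, b) ∈ x.larcs
    · rw [subst_of_mem h.choose_spec]; rfl
    · rw [subst_of_forall_notMem h]; rfl

@[simp] lemma numDist_subst (x : SlarcDiagram) (l : SlarcLetter) :
    (subst x l).numDist = l.numDist := by
  cases l with
  | sarc f s => rfl
  | larc f b =>
    by_cases h : ∃ i, (i, b) ∈ x.larcs
    · rw [subst_of_mem h.choose_spec]; rfl
    · rw [subst_of_forall_notMem h]; rfl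

/-- A long arc cut by `y`, or by `x` afterwards, becomes in either case an unmarked short arc with
the same distinction. -/
lemma subst_subst (x y : SlarcDiagram) (l : SlarcLetter) :
    subst x (subst y l) = subst (concat x y) l := by
  cases l with
  | sarc f s => rfl
  | larc f b =>
    by_cases h : ∃ i, (i, b) ∈ y.larcs
    · obtain ⟨i, hi⟩ := h
      rw [subst_of_mem hi]
      by_cases h' : ∃ j, (j, i) ∈ x.larcs
      · obtain ⟨j, hj⟩ := h'
        rw [subst_of_mem hj, subst_of_mem (mem_concat.2 ⟨i, hj, hi⟩)]
      · rw [subst_of_forall_notMem h', subst_of_forall_notMem]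
        rintro ⟨j, hj⟩
        obtain ⟨l, h1, h2⟩ := mem_concat.1 hj
        exact h' ⟨j, y.larc_eq_right h2 hi ▸ h1⟩
    · rw [subst_of_forall_notMem h, subst_of_forall_notMem, subst_sarc]
      rintro ⟨j, hj⟩
      obtain ⟨l, -, h2⟩ := mem_concat.1 hj
      exact h ⟨l, h2⟩

end SlarcLetter

open SlarcLetter

/-- Words in the letters, read from bottom to top along the right line of a diagram. -/
abbrev SlarcWord : Type := List SlarcLetter

namespace SlarcWord

/-- The homological degree of a word. -/
def degree : SlarcWord → ℕ
  | [] => 0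
  | l :: w => l.degree + degree w

/-- The number of distinguished points of a word. -/
def numDist : SlarcWord → ℕ
  | [] => 0
  | l :: w => l.numDist + numDist w

/-- The number of letters that are not marked short arcs. -/
def slots : SlarcWord → ℕ
  | [] => 0
  | larc _ _ :: w => slots w + 1
  | sarc _ false :: w => slots w + 1
  | sarc _ true :: w => slots w

/-- The number of long arcs of a word. -/
def numLarcs : SlarcWord → ℕ
  | [] => 0
  | larc _ _ :: w => numLarcs w + 1
  | sarc _ _ :: w => numLarcs w

/-- The left ends of the long arcs are increasing, at least `a` and less than `m`. -/
def Valid (m : ℕ) : ℕ → SlarcWord → Prop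
  | a, [] => a ≤ m
  | a, larc _ b :: w => a ≤ b ∧ Valid m (b + 1) w
  | a, sarc _ _ :: w => Valid m a w

/-- The long arcs of a word, its unmarked letters being numbered starting with `c`. -/
def larcsFrom : ℕ → SlarcWord → Finset (ℕ × ℕ)
  | _, [] => ∅
  | c, larc _ b :: w => insert (b, c) (larcsFrom (c + 1) w)
  | c, sarc _ false :: w => larcsFrom (c + 1) w
  | c, sarc _ true :: w => larcsFrom c w

/-- The generator of a word: its unmarked letters become long arcs with left ends `c`, `c + 1`, … -/
def genFrom : ℕ → SlarcWord → SlarcWord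
  | _, [] => []
  | c, larc f _ :: w => larc f c :: genFrom (c + 1) w
  | c, sarc f false :: w => larc f c :: genFrom (c + 1) w
  | c, sarc f true :: w => sarc f true :: genFrom c w

/-- The word has no short arcs. -/
def NoSarcs : SlarcWord → Prop
  | [] => True
  | larc _ _ :: w => NoSarcs w
  | sarc _ _ :: _ => False

/-- The word `larc true a, larc true (a + 1), …` of length `d`. -/
def fullWord : ℕ → ℕ → SlarcWord
  | _, 0 => []
  | a, d + 1 => larc true a :: fullWord (a + 1) d

lemma Valid.mono {m a a' : ℕ} {w : SlarcWord} (h : Valid m a w) (ha : a' ≤ a) :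
    Valid m a' w := by
  induction w with
  | nil => exact ha.trans h
  | cons l w ih =>
    cases l with
    | larc f b => exact ⟨ha.trans h.1, h.2⟩
    | sarc f s => exact ih h

lemma Valid.le {m a : ℕ} {w : SlarcWord} (h : Valid m a w) : a + numLarcs w ≤ m := by
  induction w generalizing a with
  | nil => exact h
  | cons l w ih =>
    cases l with
    | larc f b =>
      have h1 := ih h.2
      have h2 := h.1
      simp only [numLarcs]
      omega
    | sarc f s => exact ih h

lemma Valid.le_of_mem {m a b : ℕ} {f : Bool} {w : SlarcWord} (h : Valid m a w)
    (hb : larc f b ∈ w) : a ≤ b := by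
  induction w generalizing a with
  | nil => simp at hb
  | cons l w ih =>
    cases l with
    | larc f' b' =>
      rcases List.mem_cons.1 hb with e | hb
      · cases e
        exact h.1
      · have h1 := ih h.2 hb
        have h2 := h.1
        omega
    | sarc f s =>
      rcases List.mem_cons.1 hb with e | hb
      · cases e
      · exact ih h hb

lemma bounds_of_mem_larcsFrom {m a c i j : ℕ} {w : SlarcWord} (h : Valid m a w)
    (hij : (i, j) ∈ larcsFrom c w) : a ≤ i ∧ i < m ∧ c ≤ j ∧ j < c + slots w := by
  induction w generalizing a c with
  | nil => simp [larcsFrom] at hij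
  | cons l w ih =>
    match l with
    | larc f b =>
      simp only [larcsFrom, Finset.mem_insert, Prod.mk.injEq] at hij
      obtain ⟨h1, h2⟩ := h
      simp only [slots]
      rcases hij with ⟨rfl, rfl⟩ | hij
      · have := h2.le
        omega
      · have := ih h2 hij
        omega
    | sarc f false =>
      have := ih h hij
      simp only [slots]
      omega
    | sarc f true => exact ih h hij

lemma planar_larcsFrom {m a c : ℕ} {w : SlarcWord} (h : Valid m a w) {i j i' j' : ℕ}
    (hp : (i, j) ∈ larcsFrom c w) (hq : (i', j') ∈ larcsFrom c w) : i < i' ↔ j < j' := by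
  induction w generalizing a c with
  | nil => simp [larcsFrom] at hp
  | cons l w ih =>
    match l with
    | larc f b =>
      simp only [larcsFrom, Finset.mem_insert, Prod.mk.injEq] at hp hq
      obtain ⟨h1, h2⟩ := h
      rcases hp with ⟨rfl, rfl⟩ | hp <;> rcases hq with ⟨rfl, rfl⟩ | hq
      · simp
      · have := bounds_of_mem_larcsFrom h2 hq
        omega
      · have := bounds_of_mem_larcsFrom h2 hp
        omega
      · exact ih h2 hp hq
    | sarc f false => exact ih (c := c + 1) h hp hq
    | sarc f true => exact ih (c := c) h hp hq

lemma card_larcsFrom {m a c : ℕ} {w : SlarcWord} (h : Valid m a w) :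
    (larcsFrom c w).card = numLarcs w := by
  induction w generalizing a c with
  | nil => rfl
  | cons l w ih =>
    match l with
    | larc f b =>
      rw [larcsFrom, Finset.card_insert_of_notMem, ih h.2, numLarcs]
      intro hm
      have := bounds_of_mem_larcsFrom h.2 hm
      omega
    | sarc f false => exact ih h
    | sarc f true => exact ih h

lemma exists_mem_larcsFrom {c i : ℕ} {w : SlarcWord} :
    (∃ j, (i, j) ∈ larcsFrom c w) ↔ ∃ f, larc f i ∈ w := by
  induction w generalizing c with
  | nil => simp [larcsFrom]
  | cons l w ih =>
    match l with
    | larc f b =>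
      simp only [larcsFrom, Finset.mem_insert, Prod.mk.injEq, exists_or, ih, List.mem_cons,
        larc.injEq]
      simp
    | sarc f false => simp [larcsFrom, ih]
    | sarc f true => simp [larcsFrom, ih]

/-- The diagram of a word, obtained by deleting the marked short arcs. -/
def toDiagram (m : ℕ) (w : SlarcWord) (h : Valid m 0 w) : SlarcDiagram where
  left := m
  right := slots w
  larcs := larcsFrom 0 w
  left_lt := fun _ hp => (bounds_of_mem_larcsFrom h hp).2.1
  right_lt := fun _ hp => by
    have := (bounds_of_mem_larcsFrom h hp).2.2.2
    omega
  planar := fun _ hp _ hq => planar_larcsFrom h hp hq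

lemma numSarcs_toDiagram {m : ℕ} {w : SlarcWord} (h : Valid m 0 w) :
    (toDiagram m w h).numSarcs + 2 * numLarcs w = m + slots w := by
  have := (toDiagram m w h).numSarcs_add
  rwa [show (toDiagram m w h).larcs.card = numLarcs w from card_larcsFrom h] at this

lemma composable_toDiagram {m : ℕ} {w : SlarcWord} (h : Valid m 0 w) {x : SlarcDiagram} :
    Composable x (toDiagram m w h) ↔ x.right = m ∧
      ∀ l < m, (∃ i, (i, l) ∈ x.larcs) ∨ ∃ f, larc f l ∈ w := by
  simp only [composable_iff, ← exists_mem_larcsFrom (c := 0) (w := w)]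
  rfl

lemma degree_map_subst (x : SlarcDiagram) (w : SlarcWord) :
    degree (w.map (subst x)) = degree w := by
  induction w with
  | nil => rfl
  | cons l w ih => simp [degree, ih]

lemma numDist_map_subst (x : SlarcDiagram) (w : SlarcWord) :
    numDist (w.map (subst x)) = numDist w := by
  induction w with
  | nil => rfl
  | cons l w ih => simp [numDist, ih]

lemma slots_map_subst (x : SlarcDiagram) (w : SlarcWord) :
    slots (w.map (subst x)) = slots w := by
  induction w with
  | nil => rfl
  | cons l w ih =>
    match l with
    | larc f b =>
      by_cases h : ∃ i, (i, b) ∈ x.larcs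
      · simp [subst_of_mem h.choose_spec, slots, ih]
      · simp [subst_of_forall_notMem h, slots, ih]
    | sarc f false => simp [slots, ih]
    | sarc f true => simp [slots, ih]

/-- Substitution changes only where unmarked letters are attached on the left, and `genFrom` forgets
this. Hence the generator is constant along the action. -/
lemma genFrom_map_subst (x : SlarcDiagram) (c : ℕ) (w : SlarcWord) :
    genFrom c (w.map (subst x)) = genFrom c w := by
  induction w generalizing c with
  | nil => rfl
  | cons l w ih =>
    match l with
    | larc f b =>
      by_cases h : ∃ i, (i, b) ∈ x.larcs
      · simp [subst_of_mem h.choose_spec, genFrom, ih]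
      · simp [subst_of_forall_notMem h, genFrom, ih]
    | sarc f false => simp [genFrom, ih]
    | sarc f true => simp [genFrom, ih]

/-- The two lower bounds `a`, `a'` and the hypothesis relating them through `x` make the induction
work: past an arc from `b` to `i`, planarity provides the new bounds `b + 1` and `i + 1`. -/
lemma Valid.map_subst {m a a' : ℕ} {w : SlarcWord} (h : Valid m a w) (x : SlarcDiagram)
    (hx : ∀ i b, (i, b) ∈ x.larcs → a ≤ b → a' ≤ i) (ha' : a' ≤ x.left) :
    Valid x.left a' (w.map (subst x)) := by
  induction w generalizing a a' with
  | nil => exact ha'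
  | cons l w ih =>
    cases l with
    | larc f b =>
      by_cases hb : ∃ i, (i, b) ∈ x.larcs
      · obtain ⟨i, hi⟩ := hb
        rw [List.map_cons, subst_of_mem hi]
        refine ⟨hx i b hi h.1, ih h.2 (fun i' b' hi' hb' => ?_) (x.left_lt _ hi)⟩
        exact (x.planar _ hi _ hi').2 hb'
      · rw [List.map_cons, subst_of_forall_notMem hb]
        exact ih h.2 (fun i' b' hi' hb' => hx i' b' hi' (by have := h.1; omega)) ha'
    | sarc f s => exact ih h hx ha'

lemma mem_larcsFrom_map_subst {x : SlarcDiagram} {c i j : ℕ} {w : SlarcWord} :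
    (i, j) ∈ larcsFrom c (w.map (subst x)) ↔ ∃ l, (i, l) ∈ x.larcs ∧ (l, j) ∈ larcsFrom c w := by
  induction w generalizing c with
  | nil => simp [larcsFrom]
  | cons l w ih =>
    match l with
    | larc f b =>
      rw [List.map_cons]
      simp only [larcsFrom, Finset.mem_insert, Prod.mk.injEq]
      by_cases hb : ∃ i, (i, b) ∈ x.larcs
      · obtain ⟨i', hi'⟩ := hb
        rw [subst_of_mem hi']
        simp only [larcsFrom, Finset.mem_insert, Prod.mk.injEq, ih]
        constructor
        · rintro (⟨rfl, rfl⟩ | ⟨l, h1, h2⟩)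
          · exact ⟨b, hi', Or.inl ⟨rfl, rfl⟩⟩
          · exact ⟨l, h1, Or.inr h2⟩
        · rintro ⟨l, h1, ⟨rfl, rfl⟩ | h2⟩
          · exact Or.inl ⟨x.larc_eq_right h1 hi', rfl⟩
          · exact Or.inr ⟨l, h1, h2⟩
      · rw [subst_of_forall_notMem hb]
        simp only [larcsFrom, ih]
        constructor
        · rintro ⟨l, h1, h2⟩
          exact ⟨l, h1, Or.inr h2⟩
        · rintro ⟨l, h1, ⟨rfl, rfl⟩ | h2⟩
          · exact absurd ⟨i, h1⟩ hb
          · exact ⟨l, h1, h2⟩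
    | sarc f false => exact ih
    | sarc f true => exact ih

lemma degree_genFrom (c : ℕ) (w : SlarcWord) : degree (genFrom c w) = degree w := by
  induction w generalizing c with
  | nil => rfl
  | cons l w ih => match l with
    | larc f b => simp [genFrom, degree, SlarcLetter.degree, ih]
    | sarc f false => simp [genFrom, degree, SlarcLetter.degree, ih]
    | sarc f true => simp [genFrom, degree, ih]

lemma numDist_genFrom (c : ℕ) (w : SlarcWord) : numDist (genFrom c w) = numDist w := by
  induction w generalizing c with
  | nil => rfl
  | cons l w ih => match l with
    | larc f b => simp [genFrom, numDist, SlarcLetter.numDist, ih]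
    | sarc f false => simp [genFrom, numDist, SlarcLetter.numDist, ih]
    | sarc f true => simp [genFrom, numDist, ih]

lemma slots_genFrom (c : ℕ) (w : SlarcWord) : slots (genFrom c w) = slots w := by
  induction w generalizing c with
  | nil => rfl
  | cons l w ih => match l with
    | larc f b => simp [genFrom, slots, ih]
    | sarc f false => simp [genFrom, slots, ih]
    | sarc f true => simp [genFrom, slots, ih]

lemma numLarcs_genFrom (c : ℕ) (w : SlarcWord) : numLarcs (genFrom c w) = slots w := by
  induction w generalizing c with
  | nil => rfl
  | cons l w ih => match l with
    | larc f b => simp [genFrom, slots, numLarcs, ih]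
    | sarc f false => simp [genFrom, slots, numLarcs, ih]
    | sarc f true => simp [genFrom, slots, numLarcs, ih]

lemma valid_genFrom {m c : ℕ} {w : SlarcWord} (h : c + slots w ≤ m) : Valid m c (genFrom c w) := by
  induction w generalizing c with
  | nil => exact h
  | cons l w ih => match l with
    | larc f b =>
      simp only [slots] at h
      exact ⟨le_rfl, ih (by omega)⟩
    | sarc f false =>
      simp only [slots] at h
      exact ⟨le_rfl, ih (by omega)⟩
    | sarc f true => exact ih (c := c) h

/-- The diagram of a word rebuilds the word from its generator. Agreement of `y` with the arcs of
`w` is required only from position `c` on, because the induction keeps `y` fixed while letters are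
removed from the front. -/
lemma map_subst_genFrom {m a c : ℕ} {w : SlarcWord} (h : Valid m a w) (y : SlarcDiagram)
    (hy : ∀ i j, c ≤ j → ((i, j) ∈ y.larcs ↔ (i, j) ∈ larcsFrom c w)) :
    (genFrom c w).map (subst y) = w := by
  induction w generalizing a c with
  | nil => rfl
  | cons l w ih => match l with
    | larc f b =>
      rw [genFrom, List.map_cons, ih h.2, subst_of_mem ((hy b c le_rfl).2 (by simp [larcsFrom]))]
      intro i j hj
      rw [hy i j (by omega)]
      simp only [larcsFrom, Finset.mem_insert, Prod.mk.injEq, or_iff_right_iff_imp]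
      omega
    | sarc f false =>
      rw [genFrom, List.map_cons, ih (a := a) h, subst_of_forall_notMem]
      · rintro ⟨i, hi⟩
        have := bounds_of_mem_larcsFrom (a := a) (m := m) (w := w) h ((hy i c le_rfl).1 hi)
        omega
      · exact fun i j hj => hy i j (by omega)
    | sarc f true =>
      rw [genFrom, List.map_cons, ih (a := a) h hy, subst_sarc]

end SlarcWord

open SlarcWord

/-- The words of given homological degree `i` with `n` distinguished points over `m` left points. -/
def stateSet (n i m : ℕ) : Set SlarcWord := {w | Valid m 0 w ∧ degree w = i ∧ numDist w = n}

/-- The basis of the term of homological degree `i` of the resolution of the simple module `L_n`. -/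
@[ext]
structure SlarcState (n i : ℕ) where
  points : ℕ
  word : SlarcWord
  mem : word ∈ stateSet n i points

namespace SlarcState

variable {n i : ℕ}

lemma valid (p : SlarcState n i) : Valid p.points 0 p.word := p.mem.1

/-- The generators are the words in which each unmarked letter is a long arc and the left ends are
consecutive from `0`. Such a word is determined by which letters are marked and which are
distinguished; if it has `r` unmarked letters, it contributes a summand `A^- 1_r`. -/
noncomputable instance : DiagramSet (SlarcState n i) where
  diagram p := toDiagram p.points p.word p.valid
  act x p := ⟨x.left, p.word.map (subst x),
    p.valid.map_subst x (fun _ _ _ _ => Nat.zero_le _) (Nat.zero_le _),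
    (degree_map_subst x _).trans p.mem.2.1, (numDist_map_subst x _).trans p.mem.2.2⟩
  gen p := ⟨slots p.word, genFrom 0 p.word, valid_genFrom (by simp),
    (degree_genFrom _ _).trans p.mem.2.1, (numDist_genFrom _ _).trans p.mem.2.2⟩
  diagram_act := by
    intro x p _
    ext1
    · rfl
    · exact slots_map_subst x p.word
    · ext ⟨i, j⟩
      rw [mem_concat]
      exact mem_larcsFrom_map_subst
  act_act := by
    intro x y p _
    refine SlarcState.ext rfl ?_
    change (p.word.map (subst y)).map (subst x) = p.word.map (subst (concat x y))
    rw [List.map_map]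
    exact List.map_congr_left fun l _ => subst_subst x y l
  gen_act := by
    intro x p _
    exact SlarcState.ext (slots_map_subst x p.word) (genFrom_map_subst x 0 p.word)
  diagram_gen := by
    intro p
    have hv : Valid (slots p.word) 0 (genFrom 0 p.word) := valid_genFrom (by simp)
    have h := numSarcs_toDiagram hv
    rw [slots_genFrom, numLarcs_genFrom] at h
    refine (eq_one_of_numSarcs_eq_zero (by omega : (toDiagram _ _ hv).numSarcs = 0)).trans ?_
    exact congrArg one (slots_genFrom 0 p.word)
  act_gen := by
    intro p
    refine SlarcState.ext rfl ?_
    exact map_subst_genFrom p.valid _ fun _ _ _ => Iff.rfl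

lemma diagram_eq (p : SlarcState n i) :
    DiagramSet.diagram p = toDiagram p.points p.word p.valid := rfl

end SlarcState

/-! ### Elementary steps of the differential. -/

namespace SlarcWord

/-- `Step w w'` means that `w'` is obtained from `w` by deleting a long arc that is not
distinguished or by unmarking a marked short arc. -/
inductive Step : SlarcWord → SlarcWord → Prop
  | erase (a : ℕ) (w : SlarcWord) : Step (larc false a :: w) w
  | unmark (f : Bool) (w : SlarcWord) : Step (sarc f true :: w) (sarc f false :: w)
  | cons (l : SlarcLetter) {w w' : SlarcWord} (h : Step w w') : Step (l :: w) (l :: w')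

lemma Step.degree_eq {w w' : SlarcWord} (h : Step w w') : degree w = degree w' + 1 := by
  induction h with
  | erase a w => simp [degree, SlarcLetter.degree, add_comm]
  | unmark f w => simp [degree, SlarcLetter.degree]; omega
  | cons l h ih => simp [degree, ih, add_assoc]

lemma Step.numDist_eq {w w' : SlarcWord} (h : Step w w') : numDist w = numDist w' := by
  induction h with
  | erase a w => simp [numDist, SlarcLetter.numDist]
  | unmark f w => simp [numDist, SlarcLetter.numDist]
  | cons l h ih => simp [numDist, ih]

/-- Over `m` left points the diagram of `w` has `m + slots w - 2 * numLarcs w` short arcs, so the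
identity says that a step creates exactly one short arc. This is the linearity of the resolution. -/
lemma Step.slots_add {w w' : SlarcWord} (h : Step w w') :
    slots w' + 2 * numLarcs w = slots w + 2 * numLarcs w' + 1 := by
  induction h with
  | erase a w => simp only [slots, numLarcs]; omega
  | unmark f w => simp only [slots, numLarcs]; omega
  | cons l h ih =>
    match l with
    | larc f b => simp only [slots, numLarcs]; omega
    | sarc f false => simp only [slots, numLarcs]; omega
    | sarc f true => simp only [slots, numLarcs]; omega

/-- Unmarking keeps the letter a short arc, so words with and without short arcs span separate
subcomplexes, which are contracted separately. -/
lemma Step.noSarcs_iff {w w' : SlarcWord} (h : Step w w') : NoSarcs w ↔ NoSarcs w' := by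
  induction h with
  | erase a w => rfl
  | unmark f w => rfl
  | cons l h ih =>
    cases l with
    | larc f b => exact ih
    | sarc f s => rfl

lemma Step.valid {m a : ℕ} {w w' : SlarcWord} (h : Step w w') (hv : Valid m a w) :
    Valid m a w' := by
  induction h generalizing a with
  | erase b w => exact hv.2.mono (by have := hv.1; omega)
  | unmark f w => exact hv
  | cons l h ih =>
    cases l with
    | larc f b => exact ⟨hv.1, ih hv.2⟩
    | sarc f s => exact ih (a := a) hv

lemma Step.mem_stateSet {n i m : ℕ} {w w' : SlarcWord} (h : Step w w')
    (hw : w ∈ stateSet n (i + 1) m) : w' ∈ stateSet n i m :=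
  ⟨h.valid hw.1, by have := h.degree_eq; have := hw.2.1; omega, h.numDist_eq ▸ hw.2.2⟩

end SlarcWord

section Supported

variable {k : Type u} [Field k] {α : Type*} {M : Type*} [AddCommGroup M] [Module k M]

lemma Finsupp.map_mem_of_mem_supported {s : Set α} {p : Submodule k M} {T : (α →₀ k) →ₗ[k] M}
    (h : ∀ a ∈ s, T (Finsupp.single a 1) ∈ p) {q : α →₀ k} (hq : q ∈ Finsupp.supported k k s) :
    T q ∈ p := by
  rw [Finsupp.supported_eq_span_single] at hq
  have : Submodule.span k ((fun i => Finsupp.single i (1 : k)) '' s) ≤ p.comap T := by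
    rw [Submodule.span_le]
    rintro _ ⟨a, ha, rfl⟩
    exact h a ha
  exact this hq

/-- Many identities hold only for words satisfying a side condition (valid, of given degree,
reachable by a step). This extends them to combinations of such words. -/
lemma Finsupp.map_eq_of_mem_supported {s : Set α} {T T' : (α →₀ k) →ₗ[k] M}
    (h : ∀ a ∈ s, T (Finsupp.single a 1) = T' (Finsupp.single a 1)) {q : α →₀ k}
    (hq : q ∈ Finsupp.supported k k s) : T q = T' q := by
  have : (T - T') q ∈ (⊥ : Submodule k M) :=
    Finsupp.map_mem_of_mem_supported (fun a ha => by simp [h a ha]) hq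
  rwa [Submodule.mem_bot, LinearMap.sub_apply, sub_eq_zero] at this

end Supported

/-! ### The differential on words. -/

namespace SlarcWord

noncomputable section

variable (k : Type u) [Field k]

/-- Prefixing words with a letter. -/
def consLin (l : SlarcLetter) : (SlarcWord →₀ k) →ₗ[k] (SlarcWord →₀ k) :=
  Finsupp.lmapDomain k k (List.cons l)

@[simp] lemma consLin_single (l : SlarcLetter) (w : SlarcWord) (c : k) :
    consLin k l (Finsupp.single w c) = Finsupp.single (l :: w) c := by
  simp [consLin, Finsupp.mapDomain_single]

/-- The sign of a letter. -/
def sign (l : SlarcLetter) : k := (-1) ^ l.degree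

lemma consLin_mem {l : SlarcLetter} {s t : Set SlarcWord} (h : ∀ w ∈ s, l :: w ∈ t)
    {q : SlarcWord →₀ k} (hq : q ∈ Finsupp.supported k k s) :
    consLin k l q ∈ Finsupp.supported k k t := by
  refine Finsupp.map_mem_of_mem_supported (fun w hw => ?_) hq
  rw [consLin_single]
  exact Finsupp.single_mem_supported k 1 (h w hw)

/-- The terms of the differential of `l :: w` that come from the letter `l`. -/
def diffHead : SlarcLetter → (SlarcWord →₀ k) →ₗ[k] (SlarcWord →₀ k)
  | larc true _ => 0
  | larc false _ => LinearMap.id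
  | sarc _ false => 0
  | sarc f true => consLin k (sarc f false)

/-- The differential of a word: the derivation that maps the letters `larc false a` to the empty
word and `sarc f true` to `sarc f false`. -/
def diffWord : SlarcWord → (SlarcWord →₀ k)
  | [] => 0
  | l :: w => diffHead k l (Finsupp.single w 1) + sign k l • consLin k l (diffWord w)

/-- The differential. -/
def diff : (SlarcWord →₀ k) →ₗ[k] (SlarcWord →₀ k) := Finsupp.linearCombination k (diffWord k)

@[simp] lemma diff_single (w : SlarcWord) : diff k (Finsupp.single w 1) = diffWord k w := by
  simp [diff]

/-- The graded Leibniz rule, extended from words to linear combinations. -/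
lemma diff_consLin (l : SlarcLetter) (q : SlarcWord →₀ k) :
    diff k (consLin k l q) = diffHead k l q + sign k l • consLin k l (diff k q) := by
  have : diff k ∘ₗ consLin k l = diffHead k l + sign k l • consLin k l ∘ₗ diff k := by
    refine Finsupp.lhom_ext' fun w => LinearMap.ext_ring ?_
    simp [diffWord]
  exact LinearMap.congr_fun this q

/-- An odd derivation squares to zero once it does so on letters. The mixed terms cancel because
differentiating a letter changes the parity of its degree. -/
lemma diff_diffWord (w : SlarcWord) : diff k (diffWord k w) = 0 := by
  induction w with
  | nil => simp [diffWord]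
  | cons l w ih =>
    rw [diffWord, map_add, map_smul, diff_consLin, ih]
    match l with
    | larc true a => simp [diffHead]
    | larc false a => simp [diffHead, sign, SlarcLetter.degree]
    | sarc f false => simp [diffHead]
    | sarc true true => simp [diffHead, sign, SlarcLetter.degree, diffWord]
    | sarc false true => simp [diffHead, sign, SlarcLetter.degree, diffWord]

lemma diffWord_mem (w : SlarcWord) : diffWord k w ∈ Finsupp.supported k k {w' | Step w w'} := by
  induction w with
  | nil => exact Submodule.zero_mem _
  | cons l w ih =>
    refine Submodule.add_mem _ ?_
      (Submodule.smul_mem _ _ (consLin_mem k (fun w' h => .cons l h) ih))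
    match l with
    | larc true a => exact Submodule.zero_mem _
    | larc false a => exact Finsupp.single_mem_supported k 1 (Step.erase a w)
    | sarc f false => exact Submodule.zero_mem _
    | sarc f true =>
      rw [diffHead, consLin_single]
      exact Finsupp.single_mem_supported k 1 (Step.unmark f w)

lemma diffWord_mem_of_step {w : SlarcWord} {s : Set SlarcWord} (h : ∀ w', Step w w' → w' ∈ s) :
    diffWord k w ∈ Finsupp.supported k k s :=
  Finsupp.supported_mono h (diffWord_mem k w)

lemma diffWord_eq_zero {w : SlarcWord} (h : degree w = 0) : diffWord k w = 0 := by
  have : diffWord k w ∈ Finsupp.supported k k (∅ : Set SlarcWord) :=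
    diffWord_mem_of_step k fun w' h' => by have := h'.degree_eq; omega
  simpa using this

/-! ### The contracting homotopy -/

/-- Marks the first short arc. -/
def markWord : SlarcWord → (SlarcWord →₀ k)
  | [] => 0
  | larc f b :: w => sign k (larc f b) • consLin k (larc f b) (markWord w)
  | sarc f false :: w => Finsupp.single (sarc f true :: w) 1
  | sarc _ true :: _ => 0

/-- The linear extension of `markWord`. -/
def mark : (SlarcWord →₀ k) →ₗ[k] (SlarcWord →₀ k) := Finsupp.linearCombination k (markWord k)

@[simp] lemma mark_single (w : SlarcWord) : mark k (Finsupp.single w 1) = markWord k w := by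
  simp [mark]

lemma mark_consLin_larc (f : Bool) (b : ℕ) (q : SlarcWord →₀ k) :
    mark k (consLin k (larc f b) q) =
      sign k (larc f b) • consLin k (larc f b) (mark k q) := by
  have : mark k ∘ₗ consLin k (larc f b) =
      sign k (larc f b) • consLin k (larc f b) ∘ₗ mark k := by
    refine Finsupp.lhom_ext' fun w => LinearMap.ext_ring ?_
    simp [markWord]
  exact LinearMap.congr_fun this q

lemma mark_consLin_sarc_false (f : Bool) (q : SlarcWord →₀ k) :
    mark k (consLin k (sarc f false) q) = consLin k (sarc f true) q := by
  have : mark k ∘ₗ consLin k (sarc f false) = consLin k (sarc f true) := by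
    refine Finsupp.lhom_ext' fun w => LinearMap.ext_ring ?_
    simp [markWord]
  exact LinearMap.congr_fun this q

lemma mark_consLin_sarc_true (f : Bool) (q : SlarcWord →₀ k) :
    mark k (consLin k (sarc f true) q) = 0 := by
  have : mark k ∘ₗ consLin k (sarc f true) = 0 := by
    refine Finsupp.lhom_ext' fun w => LinearMap.ext_ring ?_
    simp [markWord]
  exact LinearMap.congr_fun this q

/-- At the first short arc the complex has the factor `sarc f true → sarc f false`, an isomorphism
inverted by marking. The signs of these two letters are opposite, so the terms that differentiate
the rest of the word cancel. -/
lemma diff_mark_add {w : SlarcWord} (h : ¬ NoSarcs w) :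
    diff k (markWord k w) + mark k (diffWord k w) = Finsupp.single w 1 := by
  induction w with
  | nil => exact absurd trivial h
  | cons l w ih =>
    match l with
    | larc true b =>
      rw [← consLin_single, ← ih h]
      simp [markWord, diffWord, diff_consLin, mark_consLin_larc, diffHead, sign,
        SlarcLetter.degree]
    | larc false b =>
      rw [← consLin_single, ← ih h]
      simp [markWord, diffWord, diff_consLin, mark_consLin_larc, diffHead, sign,
        SlarcLetter.degree]
    | sarc f false =>
      rw [markWord, ← consLin_single, diff_consLin]
      cases f <;> simp [diffWord, mark_consLin_sarc_false, diffHead, sign, SlarcLetter.degree]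
    | sarc f true =>
      cases f <;> simp [markWord, diffWord, mark_consLin_sarc_true, diffHead, sign,
        SlarcLetter.degree]

lemma markWord_mem (m a : ℕ) {w : SlarcWord} (h : Valid m a w) :
    markWord k w ∈ Finsupp.supported k k {w' | Step w' w ∧ Valid m a w'} := by
  induction w generalizing a with
  | nil => exact Submodule.zero_mem _
  | cons l w ih =>
    match l with
    | larc f b =>
      refine Submodule.smul_mem _ _ (consLin_mem k (fun w' h' => ?_) (ih (b + 1) h.2))
      exact ⟨.cons _ h'.1, h.1, h'.2⟩
    | sarc f false =>
      refine Finsupp.single_mem_supported k 1 ?_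
      exact ⟨Step.unmark f w, h⟩
    | sarc f true => exact Submodule.zero_mem _

/-- Inserts, in a word without short arcs, the first left point `≥ a` that is not distinguished. -/
def insertWord (m : ℕ) : ℕ → SlarcWord → (SlarcWord →₀ k)
  | a, [] => if a < m then Finsupp.single [larc false a] 1 else 0
  | a, larc f b :: w =>
    if b = a then cond f (consLin k (larc f b) (insertWord m (a + 1) w)) 0
    else Finsupp.single (larc false a :: larc f b :: w) 1
  | _, sarc _ _ :: _ => 0

/-- The linear extension of `insertWord`. -/
def insertLin (m a : ℕ) : (SlarcWord →₀ k) →ₗ[k] (SlarcWord →₀ k) :=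
  Finsupp.linearCombination k (insertWord k m a)

@[simp] lemma insertLin_single (m a : ℕ) (w : SlarcWord) :
    insertLin k m a (Finsupp.single w 1) = insertWord k m a w := by
  simp [insertLin]

lemma insertLin_consLin_true (m a : ℕ) (q : SlarcWord →₀ k) :
    insertLin k m a (consLin k (larc true a) q) =
      consLin k (larc true a) (insertLin k m (a + 1) q) := by
  have : insertLin k m a ∘ₗ consLin k (larc true a) =
      consLin k (larc true a) ∘ₗ insertLin k m (a + 1) := by
    refine Finsupp.lhom_ext' fun w => LinearMap.ext_ring ?_
    simp [insertWord]
  exact LinearMap.congr_fun this q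

lemma insertLin_consLin_false (m a : ℕ) (q : SlarcWord →₀ k) :
    insertLin k m a (consLin k (larc false a) q) = 0 := by
  have : insertLin k m a ∘ₗ consLin k (larc false a) = 0 := by
    refine Finsupp.lhom_ext' fun w => LinearMap.ext_ring ?_
    simp [insertWord]
  exact LinearMap.congr_fun this q

/-- All arcs start at `a + 1` or above, so the free point `a` is inserted in front. For the empty
word, validity from `a + 1` supplies `a < m`. -/
lemma insertWord_of_valid_succ {m a : ℕ} {w : SlarcWord} (h : Valid m (a + 1) w)
    (hs : NoSarcs w) : insertWord k m a w = Finsupp.single (larc false a :: w) 1 := by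
  match w with
  | [] => exact if_pos h
  | larc f b :: w =>
    have := h.1
    rw [insertWord, if_neg (by omega)]
  | sarc f s :: w => exact hs.elim

lemma insertLin_diffWord {m a : ℕ} {w : SlarcWord} (h : Valid m (a + 1) w) (hs : NoSarcs w) :
    insertLin k m a (diffWord k w) = consLin k (larc false a) (diffWord k w) := by
  refine Finsupp.map_eq_of_mem_supported (fun w' hw' => ?_) (diffWord_mem k w)
  rw [insertLin_single, consLin_single,
    insertWord_of_valid_succ k (hw'.valid h) (hw'.noSarcs_iff.1 hs)]

/-- At the first left point that is not distinguished, "absent" and "joined by an ordinary arc" form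
an acyclic pair: inserting inverts erasing. The excluded word has no such point. -/
lemma diff_insert_add {m a : ℕ} {w : SlarcWord} (h : Valid m a w) (hs : NoSarcs w)
    (hw : w ≠ fullWord a (m - a)) :
    diff k (insertWord k m a w) + insertLin k m a (diffWord k w) = Finsupp.single w 1 := by
  -- The case where `a` is absent: the arc is inserted in front, and its sign `-1` cancels the terms
  -- coming from the rest of the word.
  have key : ∀ (a : ℕ) (w : SlarcWord), Valid m (a + 1) w → NoSarcs w →
      diff k (insertWord k m a w) + insertLin k m a (diffWord k w) = Finsupp.single w 1 := by
    intro a w h hs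
    rw [insertWord_of_valid_succ k h hs, insertLin_diffWord k h hs, ← consLin_single, diff_consLin]
    simp [diffHead, sign, SlarcLetter.degree]
  induction w generalizing a with
  | nil =>
    refine key a _ (lt_of_le_of_ne h ?_) hs
    rintro rfl
    simp [fullWord] at hw
  | cons l w ih =>
    match l with
    | sarc f s => exact hs.elim
    | larc f b =>
      by_cases hab : b = a
      · subst hab
        cases f with
        | false =>
          simp only [insertWord, if_true, cond_false, map_zero, zero_add, diffWord, map_add,
            map_smul, insertLin_consLin_false, smul_zero, add_zero, diffHead, LinearMap.id_apply,
            insertLin_single]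
          exact insertWord_of_valid_succ k h.2 hs
        | true =>
          -- A full tail behind a distinguished arc at `b` would make the whole word full.
          have hw' : w ≠ fullWord (b + 1) (m - (b + 1)) := by
            rintro rfl
            have := h.2.le
            apply hw
            rw [show m - b = m - (b + 1) + 1 by omega]
            rfl
          rw [← consLin_single, ← ih h.2 hs hw']
          simp [insertWord, diffWord, diff_consLin, insertLin_consLin_true, diffHead, sign,
            SlarcLetter.degree]
      · have := h.1
        exact key a _ ⟨by omega, h.2⟩ hs

lemma insertWord_mem {m a : ℕ} {w : SlarcWord} (h : Valid m a w) :
    insertWord k m a w ∈ Finsupp.supported k k {w' | Step w' w ∧ Valid m a w'} := by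
  induction w generalizing a with
  | nil =>
    rw [insertWord]
    split_ifs with ha
    · refine Finsupp.single_mem_supported k 1 ?_
      exact ⟨Step.erase a _, le_rfl, ha⟩
    · exact Submodule.zero_mem _
  | cons l w ih =>
    match l with
    | sarc f s => exact Submodule.zero_mem _
    | larc f b =>
      rw [insertWord]
      split_ifs with ha
      · subst ha
        cases f with
        | false => exact Submodule.zero_mem _
        | true =>
          refine consLin_mem k (fun w' h' => ?_) (ih h.2)
          exact ⟨.cons _ h'.1, h.1, h'.2⟩
      · have := h.1
        refine Finsupp.single_mem_supported k 1 ?_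
        exact ⟨Step.erase a _, le_rfl, by omega, h.2⟩

open Classical in
/-- The contracting homotopy on words. -/
def homotopyWord (m : ℕ) (w : SlarcWord) : SlarcWord →₀ k :=
  if NoSarcs w then insertWord k m 0 w else markWord k w

/-- The contracting homotopy. -/
def homotopy (m : ℕ) : (SlarcWord →₀ k) →ₗ[k] (SlarcWord →₀ k) :=
  Finsupp.linearCombination k (homotopyWord k m)

@[simp] lemma homotopy_single (m : ℕ) (w : SlarcWord) :
    homotopy k m (Finsupp.single w 1) = homotopyWord k m w := by
  simp [homotopy]

/-- The differential stays within the class of words with, or without, short arcs, so the homotopy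
on `diffWord k w` is given by the same branch as on `w`. -/
lemma diff_homotopy_add {m : ℕ} {w : SlarcWord} (h : Valid m 0 w) (hw : w ≠ fullWord 0 m) :
    diff k (homotopyWord k m w) + homotopy k m (diffWord k w) = Finsupp.single w 1 := by
  by_cases hs : NoSarcs w
  · rw [homotopyWord, if_pos hs, ← diff_insert_add k h hs hw]
    congr 1
    refine Finsupp.map_eq_of_mem_supported (fun w' hw' => ?_) (diffWord_mem k w)
    rw [homotopy_single, homotopyWord, if_pos (hw'.noSarcs_iff.1 hs), insertLin_single]
  · rw [homotopyWord, if_neg hs, ← diff_mark_add k hs]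
    congr 1
    refine Finsupp.map_eq_of_mem_supported (fun w' hw' => ?_) (diffWord_mem k w)
    rw [homotopy_single, homotopyWord, if_neg fun h' => hs (hw'.noSarcs_iff.2 h'), mark_single]

lemma homotopyWord_mem {n i m : ℕ} {w : SlarcWord} (h : w ∈ stateSet n i m) :
    homotopyWord k m w ∈ Finsupp.supported k k (stateSet n (i + 1) m) := by
  have : homotopyWord k m w ∈ Finsupp.supported k k {w' | Step w' w ∧ Valid m 0 w'} := by
    rw [homotopyWord]
    split_ifs
    · exact insertWord_mem k h.1
    · exact markWord_mem k m 0 h.1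
  refine Finsupp.supported_mono (fun w' hw' => ?_) this
  refine ⟨hw'.2, ?_, ?_⟩
  · rw [hw'.1.degree_eq, h.2.1]
  · rw [hw'.1.numDist_eq, h.2.2]

/-! ### The action of diagrams -/

open Classical in
/-- The action of a diagram on a word, where the left points in `S` are taken to be the ends of
further long arcs. -/
def actWord (x : SlarcDiagram) (S : Set ℕ) (w : SlarcWord) : SlarcWord →₀ k :=
  if ∀ l < x.right, (∃ i, (i, l) ∈ x.larcs) ∨ l ∈ S ∨ ∃ f, larc f l ∈ w then
    Finsupp.single (w.map (subst x)) 1 else 0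

/-- The linear extension of `actWord`. -/
def actLin (x : SlarcDiagram) (S : Set ℕ) : (SlarcWord →₀ k) →ₗ[k] (SlarcWord →₀ k) :=
  Finsupp.linearCombination k (actWord k x S)

@[simp] lemma actLin_single (x : SlarcDiagram) (S : Set ℕ) (w : SlarcWord) :
    actLin k x S (Finsupp.single w 1) = actWord k x S w := by
  simp [actLin]

/-- `S` remembers the left points used by letters already split off: composability depends on the
whole word, so it could not otherwise be followed letter by letter. -/
lemma actWord_larc (x : SlarcDiagram) (S : Set ℕ) (f : Bool) (b : ℕ) (w : SlarcWord) :
    actWord k x S (larc f b :: w) =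
      consLin k (subst x (larc f b)) (actWord k x (insert b S) w) := by
  have : (∀ l < x.right, (∃ i, (i, l) ∈ x.larcs) ∨ l ∈ S ∨ ∃ f', larc f' l ∈ larc f b :: w) ↔
      ∀ l < x.right, (∃ i, (i, l) ∈ x.larcs) ∨ l ∈ insert b S ∨ ∃ f, larc f l ∈ w := by
    refine forall₂_congr fun l _ => or_congr_right ?_
    simp only [List.mem_cons, larc.injEq, exists_or, Set.mem_insert_iff, exists_eq_left]
    tauto
  by_cases h : ∀ l < x.right, (∃ i, (i, l) ∈ x.larcs) ∨ l ∈ insert b S ∨ ∃ f, larc f l ∈ w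
  · rw [actWord, actWord, if_pos h, if_pos (this.2 h), consLin_single, List.map_cons]
  · rw [actWord, actWord, if_neg h, if_neg (mt this.1 h), map_zero]

lemma actLin_larc (x : SlarcDiagram) (S : Set ℕ) (f : Bool) (b : ℕ) (q : SlarcWord →₀ k) :
    actLin k x S (consLin k (larc f b) q) =
      consLin k (subst x (larc f b)) (actLin k x (insert b S) q) := by
  have : actLin k x S ∘ₗ consLin k (larc f b) =
      consLin k (subst x (larc f b)) ∘ₗ actLin k x (insert b S) := by
    refine Finsupp.lhom_ext' fun w => LinearMap.ext_ring ?_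
    simp [actWord_larc]
  exact LinearMap.congr_fun this q

lemma actWord_sarc (x : SlarcDiagram) (S : Set ℕ) (f s : Bool) (w : SlarcWord) :
    actWord k x S (sarc f s :: w) = consLin k (sarc f s) (actWord k x S w) := by
  have : (∀ l < x.right, (∃ i, (i, l) ∈ x.larcs) ∨ l ∈ S ∨ ∃ f', larc f' l ∈ sarc f s :: w) ↔
      ∀ l < x.right, (∃ i, (i, l) ∈ x.larcs) ∨ l ∈ S ∨ ∃ f, larc f l ∈ w := by
    simp only [List.mem_cons, reduceCtorEq, false_or]
  by_cases h : ∀ l < x.right, (∃ i, (i, l) ∈ x.larcs) ∨ l ∈ S ∨ ∃ f, larc f l ∈ w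
  · rw [actWord, actWord, if_pos h, if_pos (this.2 h), consLin_single, List.map_cons, subst_sarc]
  · rw [actWord, actWord, if_neg h, if_neg (mt this.1 h), map_zero]

lemma actLin_sarc (x : SlarcDiagram) (S : Set ℕ) (f s : Bool) (q : SlarcWord →₀ k) :
    actLin k x S (consLin k (sarc f s) q) = consLin k (sarc f s) (actLin k x S q) := by
  have : actLin k x S ∘ₗ consLin k (sarc f s) = consLin k (sarc f s) ∘ₗ actLin k x S := by
    refine Finsupp.lhom_ext' fun w => LinearMap.ext_ring ?_
    simp [actWord_sarc]
  exact LinearMap.congr_fun this q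

lemma actWord_insert_of_mem {x : SlarcDiagram} {i b : ℕ} (h : (i, b) ∈ x.larcs) (S : Set ℕ)
    (w : SlarcWord) : actWord k x (insert b S) w = actWord k x S w := by
  have : (∀ l < x.right, (∃ i, (i, l) ∈ x.larcs) ∨ l ∈ insert b S ∨ ∃ f, larc f l ∈ w) ↔
      ∀ l < x.right, (∃ i, (i, l) ∈ x.larcs) ∨ l ∈ S ∨ ∃ f, larc f l ∈ w := by
    refine forall₂_congr fun l _ => ?_
    rw [Set.mem_insert_iff]
    constructor
    · rintro (h1 | (rfl | h1) | h1)
      · exact Or.inl h1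
      · exact Or.inl ⟨i, h⟩
      · exact Or.inr (Or.inl h1)
      · exact Or.inr (Or.inr h1)
    · tauto
  by_cases h : ∀ l < x.right, (∃ i, (i, l) ∈ x.larcs) ∨ l ∈ S ∨ ∃ f, larc f l ∈ w
  · rw [actWord, actWord, if_pos h, if_pos (this.2 h)]
  · rw [actWord, actWord, if_neg h, if_neg (mt this.1 h)]

/-- The point `b` ends no arc on either side, so concatenation would create a floating arc. Validity
enters only through `b < x.right` and through every arc of `w` starting above `b`. -/
lemma actWord_eq_zero {x : SlarcDiagram} {b : ℕ} (h : ¬ ∃ i, (i, b) ∈ x.larcs) {S : Set ℕ}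
    {w : SlarcWord} (hv : Valid x.right (b + 1) w) (hS : b ∉ S) : actWord k x S w = 0 := by
  rw [actWord, if_neg]
  intro hc
  have h1 := hv.le
  rcases hc b (by omega) with h2 | h2 | ⟨f, h2⟩
  · exact h h2
  · exact hS h2
  · have := hv.le_of_mem h2
    omega

/-- The differential commutes with the action of diagrams. -/
lemma actLin_diffWord {x : SlarcDiagram} {a : ℕ} {S : Set ℕ} {w : SlarcWord}
    (h : Valid x.right a w) (hS : ∀ l ∈ S, l < a) :
    actLin k x S (diffWord k w) = diff k (actWord k x S w) := by
  induction w generalizing a S with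
  | nil =>
    rw [diffWord, map_zero, actWord]
    split_ifs <;> simp [diffWord]
  | cons l w ih =>
    match l with
    | larc f b =>
      have hS' : ∀ l ∈ insert b S, l < b + 1 := by
        have := h.1
        rintro l (rfl | hl)
        · omega
        · have := hS l hl
          omega
      rw [actWord_larc, diff_consLin, ← ih h.2 hS', diffWord, map_add, map_smul, actLin_larc]
      have hsign : sign k (subst x (larc f b)) = sign k (larc f b) := by
        rw [sign, sign, degree_subst]
      rw [hsign]
      congr 1
      by_cases hb : ∃ i, (i, b) ∈ x.larcs
      · obtain ⟨i, hi⟩ := hb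
        rw [subst_of_mem hi, actWord_insert_of_mem k hi]
        cases f <;> simp [diffHead]
      -- Here `x` cuts the arc at `b`. The resulting unmarked short arc has no differential of its
      -- own; on the other side, erasing an ordinary arc leaves `b` uncovered and the action
      -- vanishes.
      · rw [subst_of_forall_notMem hb]
        cases f
        · simp only [diffHead, LinearMap.id_apply, actLin_single, LinearMap.zero_apply]
          refine actWord_eq_zero k hb h.2 fun hbS => ?_
          have := hS b hbS
          have := h.1
          omega
        · simp [diffHead]
    | sarc f s =>
      rw [actWord_sarc, diff_consLin, ← ih (a := a) h hS, diffWord, map_add, map_smul, actLin_sarc]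
      congr 1
      cases s
      · simp [diffHead]
      · simp [diffHead, actWord_sarc]

/-! ### Full words -/

lemma degree_fullWord (a d : ℕ) : degree (fullWord a d) = 0 := by
  induction d generalizing a with
  | zero => rfl
  | succ d ih => simp [fullWord, degree, SlarcLetter.degree, ih]

lemma numDist_fullWord (a d : ℕ) : numDist (fullWord a d) = d := by
  induction d generalizing a with
  | zero => rfl
  | succ d ih => simp [fullWord, numDist, SlarcLetter.numDist, ih, add_comm]

lemma slots_fullWord (a d : ℕ) : slots (fullWord a d) = d := by
  induction d generalizing a with
  | zero => rfl
  | succ d ih => simp [fullWord, slots, ih]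

lemma numLarcs_fullWord (a d : ℕ) : numLarcs (fullWord a d) = d := by
  induction d generalizing a with
  | zero => rfl
  | succ d ih => simp [fullWord, numLarcs, ih]

lemma valid_fullWord (a d : ℕ) : Valid (a + d) a (fullWord a d) := by
  induction d generalizing a with
  | zero => exact le_rfl
  | succ d ih => exact ⟨le_rfl, by rw [show a + (d + 1) = a + 1 + d by omega]; exact ih (a + 1)⟩

lemma numLarcs_le_slots (w : SlarcWord) : numLarcs w ≤ slots w := by
  induction w with
  | nil => exact le_rfl
  | cons l w ih =>
    match l with
    | larc f b => exact Nat.succ_le_succ ih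
    | sarc f false => exact ih.trans (Nat.le_succ _)
    | sarc f true => exact ih

/-- Increasing left ends in `[a, m)` that number `m - a` must be consecutive. Degree zero makes
every arc distinguished, and the slot count rules out unmarked short arcs. -/
lemma eq_fullWord {m a : ℕ} {w : SlarcWord} (h : Valid m a w) (hd : degree w = 0)
    (hn : a + numLarcs w = m) (hs : slots w = numLarcs w) : w = fullWord a (m - a) := by
  induction w generalizing a with
  | nil =>
    simp only [numLarcs] at hn
    rw [show m - a = 0 by omega]
    rfl
  | cons l w ih =>
    match l with
    | larc true b =>
      have h1 := h.1
      have h2 := h.2.le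
      simp only [numLarcs, slots] at hn hs
      obtain rfl : a = b := by omega
      rw [show m - a = m - (a + 1) + 1 by omega, fullWord,
        ← ih h.2 (by simpa [degree, SlarcLetter.degree] using hd) (by omega) (by omega)]
    | larc false b => simp [degree, SlarcLetter.degree] at hd
    | sarc f false =>
      have := numLarcs_le_slots w
      simp only [numLarcs, slots] at hs
      omega
    | sarc f true => simp [degree, SlarcLetter.degree] at hd

end

end SlarcWord

open DiagramSet

/-! ### The resolution of `L_n` -/

namespace SlarcResolution

noncomputable section

variable (k : Type u) [Field k] (n : ℕ)

/-- The term of homological degree `i` of the resolution of `L_n`. -/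
abbrev Term (i : ℕ) : Type u := DiagramModule k (SlarcState n i)

open Classical in
/-- The projection of the space spanned by all words to a term of the resolution. -/
def proj (i m : ℕ) : (SlarcWord →₀ k) →ₗ[k] Term k n i :=
  Finsupp.linearCombination k fun w =>
    if h : w ∈ stateSet n i m then DiagramModule.basis k (SlarcState n i) ⟨m, w, h⟩ else 0

variable {n}

lemma proj_single {i m : ℕ} {w : SlarcWord} (h : w ∈ stateSet n i m) :
    proj k n i m (Finsupp.single w 1) = DiagramModule.basis k (SlarcState n i) ⟨m, w, h⟩ := by
  rw [proj, Finsupp.linearCombination_single, one_smul, dif_pos h]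

lemma basis_eq {i : ℕ} (p : SlarcState n i) :
    DiagramModule.basis k (SlarcState n i) p = proj k n i p.points (Finsupp.single p.word 1) :=
  (proj_single k p.mem).symm

/-- The image of a diagram acting on a projection of words. -/
lemma diag_smul_proj {i : ℕ} (x : SlarcDiagram) {q : SlarcWord →₀ k}
    (hq : q ∈ Finsupp.supported k k (stateSet n i x.right)) :
    (SlarcAlgebra.diag k x : Unitization k (SlarcAlgebra k)) • proj k n i x.right q =
      proj k n i x.left (actLin k x ∅ q) := by
  refine Finsupp.map_eq_of_mem_supported
    (T := Algebra.lsmul k k _ (SlarcAlgebra.diag k x : Unitization k (SlarcAlgebra k)) ∘ₗ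
      proj k n i x.right) (T' := proj k n i x.left ∘ₗ actLin k x ∅) (fun w hw => ?_) hq
  change (SlarcAlgebra.diag k x : Unitization k (SlarcAlgebra k)) •
    proj k n i x.right (Finsupp.single w 1) = proj k n i x.left (actLin k x ∅ (Finsupp.single w 1))
  rw [proj_single k hw, actLin_single]
  have hc := composable_toDiagram hw.1 (x := x)
  by_cases h : Composable x (toDiagram x.right w hw.1)
  · rw [DiagramModule.diag_smul_basis_of_composable k h, actWord, if_pos, basis_eq]
    · rfl
    · intro l hl
      simpa using (hc.1 h).2 l hl
  · rw [DiagramModule.diag_smul_basis_of_not_composable k h, actWord, if_neg, map_zero]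
    intro hl
    exact h (hc.2 ⟨rfl, by simpa using hl⟩)

lemma diag_smul_proj_of_ne {i m : ℕ} {x : SlarcDiagram} (hx : x.right ≠ m) (q : SlarcWord →₀ k) :
    (SlarcAlgebra.diag k x : Unitization k (SlarcAlgebra k)) • proj k n i m q = 0 := by
  have : Algebra.lsmul k k _ (SlarcAlgebra.diag k x : Unitization k (SlarcAlgebra k)) ∘ₗ
      proj k n i m = 0 := by
    refine Finsupp.lhom_ext' fun w => LinearMap.ext_ring ?_
    change (SlarcAlgebra.diag k x : Unitization k (SlarcAlgebra k)) •
      proj k n i m (Finsupp.single w 1) = 0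
    rw [proj, Finsupp.linearCombination_single, one_smul]
    split_ifs with hw
    · exact DiagramModule.diag_smul_basis_of_not_composable k fun h => hx h.1
    · exact smul_zero _
  exact LinearMap.congr_fun this q

variable (n) in
/-- The differential as a `k`-linear map. -/
def differentialLin (i : ℕ) : Term k n (i + 1) →ₗ[k] Term k n i :=
  (DiagramModule.basis k (SlarcState n (i + 1))).constr k
    fun p => proj k n i p.points (diffWord k p.word)

lemma differentialLin_basis {i : ℕ} (p : SlarcState n (i + 1)) :
    differentialLin k n i (DiagramModule.basis k _ p) = proj k n i p.points (diffWord k p.word) := by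
  rw [differentialLin, Module.Basis.constr_basis]

lemma differentialLin_proj {i m : ℕ} {q : SlarcWord →₀ k}
    (hq : q ∈ Finsupp.supported k k (stateSet n (i + 1) m)) :
    differentialLin k n i (proj k n (i + 1) m q) = proj k n i m (diff k q) := by
  refine Finsupp.map_eq_of_mem_supported (T := differentialLin k n i ∘ₗ proj k n (i + 1) m)
    (T' := proj k n i m ∘ₗ diff k) (fun w hw => ?_) hq
  rw [LinearMap.comp_apply, proj_single k hw, differentialLin_basis, LinearMap.comp_apply,
    diff_single]

lemma diffWord_mem_stateSet {i m : ℕ} {w : SlarcWord} (hw : w ∈ stateSet n (i + 1) m) :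
    diffWord k w ∈ Finsupp.supported k k (stateSet n i m) :=
  diffWord_mem_of_step k fun _ h => h.mem_stateSet hw

lemma actWord_mem_stateSet {i m : ℕ} {w : SlarcWord} (hw : w ∈ stateSet n i m)
    (x : SlarcDiagram) :
    actWord k x ∅ w ∈ Finsupp.supported k k (stateSet n i x.left) := by
  rw [actWord]
  split_ifs
  · refine Finsupp.single_mem_supported k 1 ?_
    exact ⟨hw.1.map_subst x (fun _ _ _ _ => Nat.zero_le _) (Nat.zero_le _),
      (degree_map_subst x _).trans hw.2.1, (numDist_map_subst x _).trans hw.2.2⟩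
  · exact Submodule.zero_mem _

variable (n) in
/-- The differential of the resolution. -/
def differential (i : ℕ) :
    Term k n (i + 1) →ₗ[Unitization k (SlarcAlgebra k)] Term k n i :=
  LinearMap.ofCommDiag (differentialLin k n i) <| by
    intro x
    refine DiagramModule.comm_diag_of_basis _ x fun p => ?_
    obtain ⟨m, w, hw⟩ := p
    rw [differentialLin_basis, basis_eq]
    by_cases hx : x.right = m
    · subst hx
      have hw' : w ∈ stateSet n (i + 1) x.right := hw
      rw [diag_smul_proj k x (Finsupp.single_mem_supported k 1 hw'), actLin_single,
        differentialLin_proj k (actWord_mem_stateSet k hw' x),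
        diag_smul_proj k x (diffWord_mem_stateSet k hw'),
        actLin_diffWord k hw'.1 (by simp)]
    · rw [diag_smul_proj_of_ne k hx, diag_smul_proj_of_ne k hx, map_zero]

lemma differential_differential {i : ℕ} (q : Term k n (i + 2)) :
    differential k n i (differential k n (i + 1) q) = 0 := by
  have : differentialLin k n i ∘ₗ differentialLin k n (i + 1) = 0 := by
    refine (DiagramModule.basis k _).ext fun p => ?_
    rw [LinearMap.comp_apply, differentialLin_basis,
      differentialLin_proj k (diffWord_mem_stateSet k p.mem), diff_diffWord, map_zero,
      LinearMap.zero_apply]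
  exact LinearMap.congr_fun this q

variable (n) in
/-- The contracting homotopy of the resolution. -/
def contraction (i : ℕ) : Term k n i →ₗ[k] Term k n (i + 1) :=
  (DiagramModule.basis k (SlarcState n i)).constr k
    fun p => proj k n (i + 1) p.points (homotopyWord k p.points p.word)

lemma contraction_basis {i : ℕ} (p : SlarcState n i) :
    contraction k n i (DiagramModule.basis k _ p) =
      proj k n (i + 1) p.points (homotopyWord k p.points p.word) := by
  rw [contraction, Module.Basis.constr_basis]

lemma contraction_proj {i m : ℕ} {q : SlarcWord →₀ k}
    (hq : q ∈ Finsupp.supported k k (stateSet n i m)) :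
    contraction k n i (proj k n i m q) = proj k n (i + 1) m (homotopy k m q) := by
  refine Finsupp.map_eq_of_mem_supported (T := contraction k n i ∘ₗ proj k n i m)
    (T' := proj k n (i + 1) m ∘ₗ homotopy k m) (fun w hw => ?_) hq
  rw [LinearMap.comp_apply, proj_single k hw, contraction_basis, LinearMap.comp_apply,
    homotopy_single]

lemma differential_contraction_add {i : ℕ} (q : Term k n (i + 1)) :
    differential k n (i + 1) (contraction k n (i + 1) q) +
      contraction k n i (differential k n i q) = q := by
  have : differentialLin k n (i + 1) ∘ₗ contraction k n (i + 1) +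
      contraction k n i ∘ₗ differentialLin k n i = LinearMap.id := by
    refine (DiagramModule.basis k _).ext fun p => ?_
    rw [LinearMap.add_apply, LinearMap.comp_apply, LinearMap.comp_apply, contraction_basis,
      differentialLin_basis, differentialLin_proj k (homotopyWord_mem k p.mem),
      contraction_proj k (diffWord_mem_stateSet k p.mem), ← map_add, diff_homotopy_add k p.valid,
      LinearMap.id_apply, basis_eq]
    -- The exceptional word has degree `0`, whereas `p.word` has degree `i + 1`.
    intro h
    have h1 := p.mem.2.1
    rw [h, degree_fullWord] at h1
    omega
  exact LinearMap.congr_fun this q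

variable (n) in
/-- The basis vector that generates the resolution. -/
def origin : SlarcState n 0 :=
  ⟨n, fullWord 0 n, by simpa using valid_fullWord 0 n, degree_fullWord 0 n, numDist_fullWord 0 n⟩

lemma diagram_origin : diagram (origin n) = one n := by
  have h := numSarcs_toDiagram (origin n).valid
  change _ + 2 * numLarcs (fullWord 0 n) = n + slots (fullWord 0 n) at h
  rw [numLarcs_fullWord, slots_fullWord] at h
  rw [SlarcState.diagram_eq, eq_one_of_numSarcs_eq_zero
    (by omega : (toDiagram _ _ (origin n).valid).numSarcs = 0)]
  exact congrArg one (slots_fullWord 0 n)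

lemma eq_origin_of_diagram_eq_one {p : SlarcState n 0} (h : diagram p = one n) : p = origin n := by
  obtain ⟨m, w, hw⟩ := p
  have hv : Valid m 0 w := hw.1
  obtain rfl : m = n := congrArg left h
  have h1 : slots w = m := congrArg right h
  have h2 := numSarcs_toDiagram hv
  refine SlarcState.ext rfl ?_
  change w = fullWord 0 m
  have h3 : (toDiagram m w hv).numSarcs = 0 := by
    rw [show toDiagram m w hv = one m from h, numSarcs_one]
  exact eq_fullWord hv hw.2.1 (by omega) (by omega)

/-- Every point is distinguished and there are exactly `n` distinguished points, so there are `n`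
left points. -/
lemma diagram_eq_one_of_eq_fullWord {p : SlarcState n 0} (h : p.word = fullWord 0 p.points) :
    diagram p = one n := by
  have h1 := p.mem.2.2
  rw [h, numDist_fullWord] at h1
  have : p = origin n := SlarcState.ext h1 (by rw [h, h1]; rfl)
  rw [this, diagram_origin]

variable (n) in
/-- The generator of `L_n`. -/
def generator : SlarcSimple k n := (1 : k)

open Classical in
variable (n) in
/-- The augmentation as a `k`-linear map. -/
def augmentationLin : Term k n 0 →ₗ[k] SlarcSimple k n :=
  (DiagramModule.basis k (SlarcState n 0)).constr k
    fun p => if diagram p = one n then generator k n else 0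

lemma augmentationLin_of_eq {p : SlarcState n 0} (h : diagram p = one n) :
    augmentationLin k n (DiagramModule.basis k _ p) = generator k n := by
  rw [augmentationLin, Module.Basis.constr_basis, if_pos h]

lemma augmentationLin_of_ne {p : SlarcState n 0} (h : diagram p ≠ one n) :
    augmentationLin k n (DiagramModule.basis k _ p) = 0 := by
  rw [augmentationLin, Module.Basis.constr_basis, if_neg h]

variable (n) in
lemma diag_one_smul (s : SlarcSimple k n) :
    (SlarcAlgebra.diag k (one n) : Unitization k (SlarcAlgebra k)) • s = s := by
  classical
  rw [SlarcSimple.smul_def, ← Unitization.lift_symm_apply_apply, Equiv.symm_apply_apply,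
    SlarcAlgebra.coeffOne_diag, if_pos rfl, one_smul]

lemma diag_smul_of_ne {x : SlarcDiagram} (hx : x ≠ one n) (s : SlarcSimple k n) :
    (SlarcAlgebra.diag k x : Unitization k (SlarcAlgebra k)) • s = 0 := by
  classical
  rw [SlarcSimple.smul_def, ← Unitization.lift_symm_apply_apply, Equiv.symm_apply_apply,
    SlarcAlgebra.coeffOne_diag, if_neg hx, zero_smul]

variable (n) in
/-- The augmentation of the resolution. -/
def augmentation : Term k n 0 →ₗ[Unitization k (SlarcAlgebra k)] SlarcSimple k n :=
  LinearMap.ofCommDiag (augmentationLin k n) <| by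
    intro x
    refine DiagramModule.comm_diag_of_basis _ x fun p => ?_
    have h := eq_one_iff n x (diagram p)
    by_cases hc : Composable x (diagram p)
    · rw [DiagramModule.diag_smul_basis_of_composable k hc]
      simp only [hc, true_and] at h
      by_cases hp : diagram p = one n
      · rw [augmentationLin_of_eq k hp]
        by_cases hx : x = one n
        · rw [augmentationLin_of_eq k ((diagram_act hc).trans (h.2 ⟨hx, hp⟩)), hx]
          exact (diag_one_smul k n _).symm
        · rw [augmentationLin_of_ne k fun h' => hx (h.1 ((diagram_act hc).symm.trans h')).1]
          exact (diag_smul_of_ne k hx _).symm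
      · rw [augmentationLin_of_ne k hp, smul_zero,
          augmentationLin_of_ne k fun h' => hp (h.1 ((diagram_act hc).symm.trans h')).2]
    · rw [DiagramModule.diag_smul_basis_of_not_composable k hc, map_zero]
      simp only [hc, false_and, false_iff, not_and] at h
      by_cases hp : diagram p = one n
      · exact (diag_smul_of_ne k (fun hx => h hx hp) _).symm
      · rw [augmentationLin_of_ne k hp, smul_zero]

lemma numSarcs_of_step {m : ℕ} {w w' : SlarcWord} (h : Step w w') (hw : Valid m 0 w)
    (hw' : Valid m 0 w') : (toDiagram m w' hw').numSarcs = (toDiagram m w hw).numSarcs + 1 := by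
  have h1 := numSarcs_toDiagram hw
  have h2 := numSarcs_toDiagram hw'
  have h3 := h.slots_add
  omega

/-- The homological shift drops by one while the diagram gains one short arc. -/
lemma differential_mem_grading (i j : ℕ) (q : Term k n (i + 1))
    (hq : q ∈ DiagramModule.grading k (SlarcState n (i + 1)) (i + 1) j) :
    differential k n i q ∈ DiagramModule.grading k (SlarcState n i) i j := by
  have : DiagramModule.grading k (SlarcState n (i + 1)) (i + 1) j ≤
      (DiagramModule.grading k (SlarcState n i) i j).comap (differentialLin k n i) := by
    rw [DiagramModule.grading, Submodule.span_le]
    rintro _ ⟨p, hp, rfl⟩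
    change differentialLin k n i _ ∈ DiagramModule.grading k (SlarcState n i) i j
    rw [differentialLin_basis]
    refine Finsupp.map_mem_of_mem_supported (fun w' hw' => ?_) (diffWord_mem k p.word)
    have hs : Step p.word w' := hw'
    have hm := hs.mem_stateSet p.mem
    rw [proj_single k hm]
    refine Submodule.subset_span ⟨_, ?_, rfl⟩
    have h1 := numSarcs_of_step hs p.valid hm.1
    have h2 : i + 1 + (toDiagram p.points p.word p.valid).numSarcs = j := hp
    change i + (toDiagram p.points w' hm.1).numSarcs = j
    omega
  exact this hq

lemma augmentation_eq_zero (j : ℕ) (hj : j ≠ 0) (q : Term k n 0)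
    (hq : q ∈ DiagramModule.grading k (SlarcState n 0) 0 j) : augmentation k n q = 0 := by
  have : DiagramModule.grading k (SlarcState n 0) 0 j ≤ LinearMap.ker (augmentationLin k n) := by
    rw [DiagramModule.grading, Submodule.span_le]
    rintro _ ⟨p, hp, rfl⟩
    refine augmentationLin_of_ne k fun h => hj ?_
    have h2 : 0 + (diagram p).numSarcs = j := hp
    rw [← h2, h, numSarcs_one]
  exact this hq

/-- A degree argument: generators of `P^1` lie in degree `1`, so the image of the differential lies
in positive degrees, which the augmentation kills. -/
lemma augmentation_differential (q : Term k n 1) :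
    augmentation k n (differential k n 0 q) = 0 := by
  have : augmentationLin k n ∘ₗ differentialLin k n 0 = 0 := by
    refine (DiagramModule.basis k _).ext fun p => ?_
    refine augmentation_eq_zero k _ (Nat.succ_ne_zero (diagram p).numSarcs) _
      (differential_mem_grading k 0 _ _ (Submodule.subset_span ⟨p, ?_, rfl⟩))
    change 0 + 1 + _ = _ + 1
    omega
  exact LinearMap.congr_fun this q

variable (n) in
/-- The `k`-linear section of the augmentation. -/
def augmentationSection : SlarcSimple k n →ₗ[k] Term k n 0 :=
  LinearMap.toSpanSingleton k (Term k n 0) (DiagramModule.basis k (SlarcState n 0) (origin n))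

lemma augmentationSection_generator :
    augmentationSection k n (generator k n) = DiagramModule.basis k _ (origin n) :=
  one_smul k _

variable (n) in
lemma augmentation_surjective : Function.Surjective (augmentation k n) := by
  intro c
  refine ⟨augmentationSection k n c, ?_⟩
  change augmentationLin k n ((show k from c) • DiagramModule.basis k _ (origin n)) = c
  rw [map_smul, augmentationLin_of_eq k diagram_origin]
  exact mul_one (show k from c)

/-- Subtracting the multiple of the origin given by the augmentation maps every vector into the
image of the differential; on the kernel of the augmentation nothing is subtracted. -/
lemma exists_differential_eq (q : Term k n 0) (hq : augmentation k n q = 0) :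
    ∃ q', differential k n 0 q' = q := by
  have key : (⊤ : Submodule k (Term k n 0)) ≤ (LinearMap.range (differentialLin k n 0)).comap
      (LinearMap.id - augmentationSection k n ∘ₗ augmentationLin k n) := by
    rw [← (DiagramModule.basis k (SlarcState n 0)).span_eq, Submodule.span_le]
    rintro _ ⟨p, rfl⟩
    change DiagramModule.basis k _ p -
      augmentationSection k n (augmentationLin k n (DiagramModule.basis k _ p)) ∈
        LinearMap.range (differentialLin k n 0)
    by_cases hp : diagram p = one n
    · rw [augmentationLin_of_eq k hp, augmentationSection_generator,
        eq_origin_of_diagram_eq_one hp, sub_self]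
      exact Submodule.zero_mem _
    · rw [augmentationLin_of_ne k hp, map_zero, sub_zero]
      refine ⟨contraction k n 0 (DiagramModule.basis k _ p), ?_⟩
      -- In degree `0` the differential of a word vanishes, so the homotopy identity exhibits the
      -- word itself as a boundary.
      have h := diff_homotopy_add k p.valid fun h => hp (diagram_eq_one_of_eq_fullWord h)
      rw [diffWord_eq_zero k p.mem.2.1, map_zero, add_zero] at h
      rw [contraction_basis, differentialLin_proj k (homotopyWord_mem k p.mem), h, basis_eq]
  obtain ⟨q', h⟩ := key (Submodule.mem_top (x := q))
  refine ⟨q', h.trans ?_⟩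
  change q - augmentationSection k n (augmentation k n q) = q
  rw [hq, map_zero, sub_zero]

variable (n) in
/-- The linear resolution of `L_n`. -/
def resolution : LinearResolution (k := k) (SlarcAlgebra.idem k) (SlarcAlgebra.sarcGrading k)
    (SlarcSimple k n) where
  P i := Term k n i
  locallyUnital i := DiagramModule.isLocallyUnital k _
  projective i := DiagramModule.projective k _
  grading i := DiagramModule.grading k _ i
  isInternal i := DiagramModule.grading_isInternal k _ i
  smul_mem i := DiagramModule.smul_mem_grading k _ i
  generated i := DiagramModule.span_grading k _ i
  d i := differential k n i
  d_mem i := differential_mem_grading k i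
  augmentation := augmentation k n
  augmentation_eq_zero := augmentation_eq_zero k
  augmentation_surjective := augmentation_surjective k n
  exact_zero q := by
    constructor
    · exact exists_differential_eq k q
    · rintro ⟨q', rfl⟩
      exact augmentation_differential k q'
  exact_succ i q := by
    constructor
    · intro hq
      refine ⟨contraction k n (i + 1) q, ?_⟩
      have := differential_contraction_add k q
      rwa [hq, map_zero, add_zero] at this
    · rintro ⟨q', rfl⟩
      exact differential_differential k q'

end

end SlarcResolution

/-! ### Classification of the simple modules. -/

/-- A linear resolution of a module is one of every isomorphic module. -/
def LinearResolution.ofEquiv {k A : Type u} [Field k] [NonUnitalRing A] [Module k A]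
    [IsScalarTower k A A] [SMulCommClass k A A] {ι : Type*} [DecidableEq ι] {e : ι → A}
    {𝒜 : ℕ → Submodule k A} {S : Type v} [AddCommGroup S] [Module (Unitization k A) S]
    {T : Type w} [AddCommGroup T] [Module (Unitization k A) T]
    (r : LinearResolution (k := k) e 𝒜 S) (f : S ≃ₗ[Unitization k A] T) :
    LinearResolution (k := k) e 𝒜 T :=
  letI := r.addCommGroup
  letI := r.moduleBase
  letI := r.module
  letI := r.isScalarTower
  { P := r.P
    locallyUnital := r.locallyUnital
    projective := r.projective
    grading := r.grading
    isInternal := r.isInternal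
    smul_mem := r.smul_mem
    generated := r.generated
    d := r.d
    d_mem := r.d_mem
    augmentation := f.toLinearMap ∘ₗ r.augmentation
    augmentation_eq_zero := fun j hj x hx => by
      rw [LinearMap.comp_apply, r.augmentation_eq_zero j hj x hx, map_zero]
    augmentation_surjective := f.surjective.comp r.augmentation_surjective
    exact_zero := fun x => by
      rw [LinearMap.comp_apply, LinearEquiv.coe_coe, f.map_eq_zero_iff]
      exact r.exact_zero x
    exact_succ := r.exact_succ }

namespace SlarcAlgebra

variable {k : Type u} [Field k] {S : Type w} [AddCommGroup S]
  [Module (Unitization k (SlarcAlgebra k)) S]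

lemma diag_smul_diag_smul {x y : SlarcDiagram} (h : Composable x y) (s : S) :
    (diag k x : Unitization k (SlarcAlgebra k)) • (diag k y : Unitization k (SlarcAlgebra k)) • s =
      (diag k (concat x y) : Unitization k (SlarcAlgebra k)) • s := by
  rw [← mul_smul, ← Unitization.inr_mul, diag_mul_diag_of_composable k h]

lemma diag_smul_diag_smul_eq_zero {x y : SlarcDiagram} (h : ¬ Composable x y) (s : S) :
    (diag k x : Unitization k (SlarcAlgebra k)) • (diag k y : Unitization k (SlarcAlgebra k)) • s =
      0 := by
  rw [← mul_smul, ← Unitization.inr_mul, diag_mul_diag_of_not_composable k h, Unitization.inr_zero,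
    zero_smul]

variable [Module k S] [IsScalarTower k (Unitization k (SlarcAlgebra k)) S]

/-- A locally unital simple module contains a non-zero vector fixed by some `1_n` and annihilated
by all other diagrams. -/
lemma exists_vector_of_isSimpleModule (hS : IsSimpleModule (Unitization k (SlarcAlgebra k)) S)
    (hu : IsLocallyUnital (k := k) (idem k) S) :
    ∃ (n : ℕ) (v : S), v ≠ 0 ∧ (diag k (one n) : Unitization k (SlarcAlgebra k)) • v = v ∧
      ∀ x ≠ one n, (diag k x : Unitization k (SlarcAlgebra k)) • v = 0 := by
  classical
  have hex : ∃ n, ∃ s : S, (diag k (one n) : Unitization k (SlarcAlgebra k)) • s ≠ 0 := by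
    by_contra hc
    push Not at hc
    have htop := hu.submodule_iSup_eq_top
    have hbot : (⨆ n, LinearMap.range
        (Algebra.lsmul k k S (idem k n : Unitization k (SlarcAlgebra k)))) = ⊥ := by
      rw [iSup_eq_bot]
      intro n
      rw [LinearMap.range_eq_bot]
      exact LinearMap.ext fun s => hc n s
    rw [hbot] at htop
    have := IsSimpleModule.nontrivial (Unitization k (SlarcAlgebra k)) S
    obtain ⟨s, hs⟩ := exists_ne (0 : S)
    exact hs ((Submodule.mem_bot k).1 (htop ▸ Submodule.mem_top))
  -- The least `n` with `1_n S ≠ 0`; minimality kills every diagram with fewer than `n` left points.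
  obtain ⟨n, ⟨s, hs⟩, hmin⟩ : ∃ n, (∃ s : S,
      (diag k (one n) : Unitization k (SlarcAlgebra k)) • s ≠ 0) ∧
      ∀ m < n, ∀ t : S, (diag k (one m) : Unitization k (SlarcAlgebra k)) • t = 0 :=
    ⟨Nat.find hex, Nat.find_spec hex, fun m hm => by
      have := Nat.find_min hex hm
      push Not at this
      exact this⟩
  have hlt : ∀ x : SlarcDiagram, x.left < n → ∀ t : S,
      (diag k x : Unitization k (SlarcAlgebra k)) • t = 0 := by
    intro x hx t
    conv_lhs => rw [← one_concat x]
    rw [← diag_smul_diag_smul (one_composable.2 rfl)]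
    exact hmin _ hx _
  set v : S := (diag k (one n) : Unitization k (SlarcAlgebra k)) • s with hv
  have hfix : (diag k (one n) : Unitization k (SlarcAlgebra k)) • v = v := by
    have h : Composable (one n) (one n) := one_composable.2 rfl
    rw [hv, diag_smul_diag_smul h, show concat (one n) (one n) = one n from one_concat (one n)]
  have heq : ∀ x : SlarcDiagram, x.left = n → x ≠ one n →
      (diag k x : Unitization k (SlarcAlgebra k)) • v = 0 := by
    intro x hxl hx
    by_cases hxr : x.right = n
    -- A non-identity diagram from `n` to `n` points has a right short arc, hence factors as `y z`
    -- with `z.left < n`, and `z` already kills `v`.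
    · rcases x.rightSarcs.eq_empty_or_nonempty with h | h
      · refine absurd ?_ hx
        rw [← hxr]
        exact eq_one_of_forall_right (hxl.trans hxr.symm) (exists_larc_of_rightSarcs_eq_empty h)
      · obtain ⟨y, z, hyz, rfl, hz⟩ := exists_eq_concat h
        rw [← diag_smul_diag_smul hyz, hlt z (hz.trans_eq hxr), smul_zero]
    · exact diag_smul_diag_smul_eq_zero (fun h => hxr (composable_one.1 h)) s
  refine ⟨n, v, hs, hfix, fun x hx => ?_⟩
  rcases lt_trichotomy x.left n with hxl | hxl | hxl
  · exact hlt x hxl v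
  · exact heq x hxl hx
  -- If `x v ≠ 0`, simplicity gives `a x v = v`, hence `1_n a x v = v`. But `1_n a x` is a
  -- combination of diagrams with `n` left points, none equal to `1_n` because `1_n` is a product of
  -- identities only, so it kills `v`. The scalar part of `a` contributes nothing since `x.left ≠
  -- n`.
  · by_contra hne
    obtain ⟨a, ha⟩ := IsSimpleModule.toSpanSingleton_surjective
      (Unitization k (SlarcAlgebra k)) hne v
    rw [LinearMap.toSpanSingleton_apply] at ha
    refine hs ?_
    rw [← hfix, ← ha]
    induction a using Unitization.ind with
    | inl_add_inr c a =>
      have h1 : (diag k (one n) : Unitization k (SlarcAlgebra k)) •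
          (diag k x : Unitization k (SlarcAlgebra k)) • v = 0 :=
        diag_smul_diag_smul_eq_zero (fun h => hxl.ne (one_composable.1 h)) v
      have h2 : (diag k (one n) : Unitization k (SlarcAlgebra k)) •
          (a : Unitization k (SlarcAlgebra k)) •
          (diag k x : Unitization k (SlarcAlgebra k)) • v = 0 := by
        clear ha
        induction a using diag_induction with
        | hd y =>
          by_cases hyl : y.left = n
          · by_cases hyx : Composable y x
            · rw [diag_smul_diag_smul hyx, heq (concat y x) hyl, smul_zero]
              intro h
              exact hx ((eq_one_iff n y x).1 ⟨hyx, h⟩).2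
            · rw [diag_smul_diag_smul_eq_zero hyx, smul_zero]
          · exact diag_smul_diag_smul_eq_zero (fun h => hyl (one_composable.1 h).symm) _
        | h0 => simp
        | ha a b ha hb => rw [Unitization.inr_add, add_smul, smul_add, ha, hb, add_zero]
        | hs c a h => rw [Unitization.inr_smul, smul_assoc, smul_algebra_smul_comm, h, smul_zero]
      rw [add_smul, smul_add, h2, add_zero, ← Unitization.algebraMap_eq_inl, ← mul_smul,
        ← Algebra.commutes, mul_smul, h1, smul_zero]

/-- Every locally unital simple module is isomorphic to some `L_n`. -/
lemma exists_equiv_slarcSimple (hS : IsSimpleModule (Unitization k (SlarcAlgebra k)) S)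
    (hu : IsLocallyUnital (k := k) (idem k) S) :
    ∃ n, Nonempty (SlarcSimple k n ≃ₗ[Unitization k (SlarcAlgebra k)] S) := by
  obtain ⟨n, v, hv, hfix, hzero⟩ := exists_vector_of_isSimpleModule hS hu
  let g : SlarcSimple k n →ₗ[k] S := LinearMap.toSpanSingleton k S v
  have hg : ∀ c : SlarcSimple k n, g c = (show k from c) • v := fun _ => rfl
  let f : SlarcSimple k n →ₗ[Unitization k (SlarcAlgebra k)] S := LinearMap.ofCommDiag g <| by
    intro x c
    by_cases hx : x = one n
    · rw [hx, SlarcResolution.diag_one_smul, hg, smul_algebra_smul_comm, hfix]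
    · rw [SlarcResolution.diag_smul_of_ne k hx, map_zero, hg, smul_algebra_smul_comm, hzero x hx,
        smul_zero]
  have hfg : ∀ c, f c = g c := fun _ => rfl
  refine ⟨n, ⟨LinearEquiv.ofBijective f ⟨?_, ?_⟩⟩⟩
  · rw [injective_iff_map_eq_zero]
    intro c hc
    rw [hfg, hg] at hc
    exact (smul_eq_zero.1 hc).resolve_right hv
  · rw [← LinearMap.range_eq_top]
    refine (eq_bot_or_eq_top (LinearMap.range f)).resolve_left fun h => hv ?_
    rw [← Submodule.mem_bot (Unitization k (SlarcAlgebra k)), ← h]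
    exact ⟨SlarcResolution.generator k n, one_smul k v⟩

lemma nonempty_linearResolution (hS : IsSimpleModule (Unitization k (SlarcAlgebra k)) S)
    (hu : IsLocallyUnital (k := k) (idem k) S) :
    Nonempty (LinearResolution (k := k) (idem k) (sarcGrading k) S) := by
  obtain ⟨n, ⟨f⟩⟩ := exists_equiv_slarcSimple hS hu
  exact ⟨(SlarcResolution.resolution k n).ofEquiv f⟩

variable (k) in
lemma isKoszulAlgebra : IsKoszulAlgebra.{u, 0, w} (idem k) (sarcGrading k) where
  ne_zero _ := diag_ne_zero k _
  idempotent n := (idem_mul_diag k n (one n)).trans (if_pos rfl)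
  orthogonal m n h := (idem_mul_diag k m (one n)).trans (if_neg h.symm)
  peirce := peirce_isInternal k
  isInternal := sarcGrading_isInternal k
  mul_mem := mul_mem_sarcGrading k
  degree_zero := sarcGrading_zero k
  linear _ _ _ _ _ hS hu _ := nonempty_linearResolution hS hu

end SlarcAlgebra

theorem mainTheorem10 (k : Type u) [Field k] :
    IsKoszulAlgebra.{u, 0, w} (SlarcAlgebra.idem k) (SlarcAlgebra.sarcGrading k) ∧
    (∀ n : ℕ, Nonempty (LinearResolution (k := k) (SlarcAlgebra.idem k)
      (SlarcAlgebra.sarcGrading k) (SlarcSimple k n))) ∧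
    (∀ (S : Type w) [AddCommGroup S] [Module k S] [Module (Unitization k (SlarcAlgebra k)) S]
      [IsScalarTower k (Unitization k (SlarcAlgebra k)) S],
      IsSimpleModule (Unitization k (SlarcAlgebra k)) S →
      IsLocallyUnital (k := k) (SlarcAlgebra.idem k) S →
      Nonempty (LinearResolution (k := k) (SlarcAlgebra.idem k)
        (SlarcAlgebra.sarcGrading k) S)) := by
  refine ⟨SlarcAlgebra.isKoszulAlgebra k, fun n => ⟨SlarcResolution.resolution k n⟩, ?_⟩
  intro S _ _ _ _ hS hu
  exact SlarcAlgebra.nonempty_linearResolution hS hu
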